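/- Throughout, a tree is a structure $T=(V;\le)$ where $\le$ is a partial order on $V$ with a least element such that for every $x\in V$ the set $\{y\mid y\le x\}$ is finite and linearly ordered by $\le$. The level of $x$ is $|\{y \mid y<x\}|$, and the height of $T$ is the supremum of the levels of its nodes. An automatic presentation of a structure $(D;R)$ with one binary relation $R\subseteq D\times D$ is a pair of non-deterministic finite automata, one accepting the domain $D$, which is a set of words over a finite alphabet, and the other accepting the set of convolutions $\{u\otimes v\mid (u,v)\in R\}$; here $u\otimes v$ is the word of length $\max(|u|,|v|)$ whose $i$-th symbol is the pair of the $i$-th symbols of $u$ and $v$, the shorter word being padded with a symbol $\diamond$ outside the alphabet. The structure presented by $P$ is denoted $\mathcal S(P)$. For $n\ge 1$, the isomorphism problem for automatic trees of height at most $n$ is the set of all pairs $(P_1,P_2)$ of automatic presentations such that $\mathcal S(P_1)\cong\mathcal S(P_2)$ and $\mathcal S(P_2)$ is a tree of height at most $n$. Presentations are encoded effectively by natural numbers; a set belongs to $\Sigma^0_m$ if it has the form $\{a\mid \exists x_1\,\forall x_2\cdots Q x_m:\ (a,x_1,\dots,x_m)\in P\}$ with $P$ recursive, alternating quantifiers over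 $\mathbb N$, and $Q=\exists$ for odd $m$, $Q=\forall$ for even $m$; the complements of $\Sigma^0_m$-sets are the $\Pi^0_m$-sets. Proposition. The isomorphism problem for automatic trees of height at most $n$ is decidable for $n=1$, and it belongs to $\Pi^0_{2n-3}$ for every $n\ge 2$. -/

import Mathlib

namespace AutomaticTrees

/-! ### The arithmetical hierarchy -/

/-- `altQuant b m R` is the statement `Q₁ x₁ Q₂ x₂ ⋯ Qₘ xₘ : R (x₁, …, xₘ)` over the natural numbers
with alternating quantifiers, `Q₁` being `∃` if `b = true` and `∀` if `b = false`. -/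
def altQuant : Bool → (m : ℕ) → (List.Vector ℕ m → Prop) → Prop
  | _, 0, R => R List.Vector.nil
  | true, m + 1, R => ∃ x, altQuant false m fun v => R (x ::ᵥ v)
  | false, m + 1, R => ∀ x, altQuant true m fun v => R (x ::ᵥ v)

/-- `A` belongs to `Σ⁰ₘ`: there is a recursive predicate `P` with
`A = {a | ∃ x₁ ∀ x₂ ⋯ Q xₘ : P (a, x₁, …, xₘ)}`.  The elements of `A` are natural numbers or, more
generally, objects with an effective encoding by natural numbers. -/
def IsSigma {α : Type} [Primcodable α] (m : ℕ) (A : Set α) : Prop :=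
  ∃ P : α × List.Vector ℕ m → Prop, ComputablePred P ∧
    ∀ a, a ∈ A ↔ altQuant true m fun v => P (a, v)

/-- `A` belongs to `Π⁰ₘ`: its complement belongs to `Σ⁰ₘ`. -/
def IsPi {α : Type} [Primcodable α] (m : ℕ) (A : Set α) : Prop :=
  IsSigma m Aᶜ

/-- `A` is decidable. -/
def IsDecidable {α : Type} [Primcodable α] (A : Set α) : Prop :=
  ComputablePred fun a => a ∈ A

/-! ### Finite automata as finite objects -/

/-- A non-deterministic finite automaton with letters in `α`, given by the finite lists of its
transitions `(p, a, q)`, initial states and accepting states.  States are named by natural numbers;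
only finitely many states and letters occur in an automaton. -/
structure FinAut (α : Type) where
  trans : List (ℕ × α × ℕ)
  init : List ℕ
  final : List ℕ

/-- A finite automaton is the tuple of its components. -/
def FinAut.equivProd (α : Type) : FinAut α ≃ List (ℕ × α × ℕ) × List ℕ × List ℕ where
  toFun A := (A.trans, A.init, A.final)
  invFun t := ⟨t.1, t.2.1, t.2.2⟩
  left_inv _ := rfl
  right_inv _ := rfl

instance (α : Type) [Primcodable α] : Primcodable (FinAut α) :=
  Primcodable.ofEquiv _ (FinAut.equivProd α)

/-- The automaton as an `NFA` of Mathlib. -/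
def FinAut.toNFA {α : Type} (A : FinAut α) : NFA α ℕ where
  step p a := {q | (p, a, q) ∈ A.trans}
  start := {q | q ∈ A.init}
  accept := {q | q ∈ A.final}

/-- The language `L(A)` accepted by `A`. -/
def FinAut.language {α : Type} (A : FinAut α) : Language α :=
  A.toNFA.accepts

/-! ### Automatic presentations -/

/-- The convolution `u ⊗ v` of two words: its length is `max |u| |v|`, and its `i`-th symbol is the
pair of the `i`-th symbols of `u` and of `v`, where `none` is the padding symbol `⋄`. -/
def conv (u v : List ℕ) : List (Option ℕ × Option ℕ) :=
  (List.range (max u.length v.length)).map fun i => (u[i]?, v[i]?)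

/-- A pair of a finite automaton for the domain and a synchronous two-tape finite automaton for the
binary relation of a structure.  The letters of words are named by natural numbers, finitely many of
which occur in the automata. -/
structure Presentation where
  dom : FinAut ℕ
  rel : FinAut (Option ℕ × Option ℕ)

/-- A presentation is the pair of its automata. -/
def Presentation.equivProd : Presentation ≃ FinAut ℕ × FinAut (Option ℕ × Option ℕ) where
  toFun P := (P.dom, P.rel)
  invFun t := ⟨t.1, t.2⟩
  left_inv _ := rfl
  right_inv _ := rfl

instance : Primcodable Presentation :=
  Primcodable.ofEquiv _ Presentation.equivProd

/-- `P` is an automatic presentation: the second automaton recognizes the set of convolutions of the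
pairs in a binary relation on the domain, i.e. it accepts nothing but convolutions of two words of
the domain. -/
def Presentation.IsAutomatic (P : Presentation) : Prop :=
  ∀ w ∈ P.rel.language, ∃ u ∈ P.dom.language, ∃ v ∈ P.dom.language, w = conv u v

/-- The domain of the structure `S(P)`: the set of words accepted by the first automaton. -/
def Presentation.Dom (P : Presentation) : Type :=
  {w : List ℕ // w ∈ P.dom.language}

/-- The binary relation of the structure `S(P)`. -/
def Presentation.Rel (P : Presentation) (u v : P.Dom) : Prop :=
  conv u.1 v.1 ∈ P.rel.language

/-- The isomorphism problem for a class `K` of structures with one binary relation: the set of pairs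
`(P₁, P₂)` of automatic presentations with `S(P₁) ≅ S(P₂) ∈ K`. -/
def isoProblem (K : (D : Type) → (D → D → Prop) → Prop) : Set (Presentation × Presentation) :=
  {p | p.1.IsAutomatic ∧ p.2.IsAutomatic ∧ Nonempty (p.1.Rel ≃r p.2.Rel) ∧ K p.2.Dom p.2.Rel}

/-! ### Trees -/

/-- `(V; r)` is a tree: `r` is a partial order with a least element, and for every `x` the set of
ancestors `{y | r y x}` is finite and linearly ordered by `r`. -/
structure IsTree {V : Type} (r : V → V → Prop) : Prop where
  refl : ∀ x, r x x
  antisymm : ∀ x y, r x y → r y x → x = y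
  trans : ∀ x y z, r x y → r y z → r x z
  root : ∃ o, ∀ x, r o x
  finite : ∀ x, {y | r y x}.Finite
  linear : ∀ x y z, r y x → r z x → r y z ∨ r z y

/-- The level of a node `x`: the number of nodes strictly below `x`. -/
noncomputable def level {V : Type} (r : V → V → Prop) (x : V) : ℕ∞ :=
  {y | r y x ∧ y ≠ x}.encard

/-- The height of a tree: the supremum of the levels of its nodes. -/
noncomputable def height {V : Type} (r : V → V → Prop) : ℕ∞ :=
  ⨆ x, level r x

/-- The class of trees of height at most `n`. -/
def TreeOfHeightLE (n : ℕ) (V : Type) (r : V → V → Prop) : Prop :=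
  IsTree r ∧ height r ≤ n

end AutomaticTrees

/-! A countable tree of height at most `k + 1` is determined up to isomorphism by an invariant of
its root (`inv`). For `k = 0` this is the number of descendants in `ℕ∞`; at `k + 1` it is the
function sending each value `t` of the previous invariant to the number of children with value `t`.
If the invariants of two roots agree, their children can be matched so that invariants are
preserved, and the isomorphisms between the subtrees can be glued (`nonempty_subtree_iso`).
Countability makes counting in `ℕ∞` sufficient.

The effective part rests on pumping. If the quotients of a set of words by words of length at least
`s` fall into at most `N` colours (`PumpAt`), and the letters are bounded, then the set is infinite
iff it has a word of length at least `s + N`, and then it has one shorter than `s + 2 * N`. A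
bounded search therefore finds its cardinality (`exists_primrec_encard`). The colouring property is
stable under Boolean operations and holds for the set of `y` onto which exactly `κ` words of a
regular language project (`PumpAt.encard_fiber_eq`). Hence the numbers of ancestors, of descendants,
and of children with exactly `κ` descendants are primitive recursive.

Consequently inequality of invariants at `k = 1` is `Σ⁰₁`: some `κ` is counted differently. If
inequality at `k` is `Σ⁰ₘ` with `m ≥ 1`, then "at least `l` children of `x` have the invariant of
`w`" asks for a list of `l` children satisfying a `Π⁰ₘ` condition, so it is `Σ⁰ₘ₊₁`. Invariants at
`k + 1` differ iff for some `w` and `l` this holds at one node and fails at the other, which is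
`Σ⁰ₘ₊₂`. At `k = j + 1` this gives level `2 * j + 1`, which is `2 * n - 3` for height `n = j + 2`.
Presenting a tree of height at most `n` is only a `Π⁰₁` condition.

For height one, pumping also bounds the code of the root and makes it decidable whether a given word
is the root of such a tree; the numbers of descendants of the two roots are then compared. -/

namespace AutomaticTrees

/-! ### Levels of the arithmetical hierarchy over primitive recursive predicates -/

/-- `SigmaPred m p`: the predicate `p` arises from a primitive recursive predicate by `m` steps, each
of which forms `∃ x, ¬ q (a, x)` from `q`. -/
def SigmaPred : ℕ → (α : Type) → [Primcodable α] → (α → Prop) → Prop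
  | 0, _, _, p => PrimrecPred p
  | m + 1, α, _, p => ∃ q : α × ℕ → Prop, SigmaPred m (α × ℕ) q ∧ ∀ a, p a ↔ ∃ x, ¬ q (a, x)

namespace SigmaPred

variable {α β : Type} [Primcodable α] [Primcodable β] {m : ℕ}

theorem of_eq {p q : α → Prop} (hp : SigmaPred m α p) (h : ∀ a, p a ↔ q a) : SigmaPred m α q :=
  (funext fun a => propext (h a) : p = q) ▸ hp

theorem comp {p : β → Prop} {f : α → β} (hp : SigmaPred m β p) (hf : Primrec f) :
    SigmaPred m α fun a => p (f a) := by
  induction m generalizing α β with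
  | zero => exact PrimrecPred.comp hp hf
  | succ m ih =>
    obtain ⟨q, hq, h⟩ := hp
    exact ⟨fun a => q (f a.1, a.2), ih (f := fun a : α × ℕ => (f a.1, a.2)) hq
      ((hf.comp .fst).pair .snd), fun a => h (f a)⟩

theorem of_not {p : α → Prop} (hp : SigmaPred m α fun a => ¬ p a) : SigmaPred (m + 1) α p :=
  ⟨_, hp.comp .fst, fun a => by simp⟩

theorem succ {p : α → Prop} (hp : SigmaPred m α p) : SigmaPred (m + 1) α p := by
  induction m generalizing α with
  | zero => exact of_not (PrimrecPred.not hp)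
  | succ m ih =>
    obtain ⟨q, hq, h⟩ := hp
    exact ⟨q, ih hq, h⟩

theorem mono {p : α → Prop} {n : ℕ} (hp : SigmaPred m α p) (h : m ≤ n) : SigmaPred n α p := by
  induction n, h using Nat.le_induction with
  | base => exact hp
  | succ n _ ih => exact ih.succ

/-- One induction serves both claims: because each level is `∃ ¬`, a conjunction at level `m + 1`
comes from a disjunction at level `m`, and conversely. The two witnesses of a conjunction are coded
into one number. -/
theorem and_or {p q : α → Prop} (hp : SigmaPred m α p) (hq : SigmaPred m α q) :
    (SigmaPred m α fun a => p a ∧ q a) ∧ SigmaPred m α fun a => p a ∨ q a := by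
  induction m generalizing α with
  | zero => exact ⟨PrimrecPred.and hp hq, PrimrecPred.or hp hq⟩
  | succ m ih =>
    obtain ⟨p', hp', h1⟩ := hp
    obtain ⟨q', hq', h2⟩ := hq
    constructor
    · have e1 : Primrec fun a : α × ℕ => (a.1, a.2.unpair.1) :=
        Primrec.fst.pair (Primrec.fst.comp (Primrec.unpair.comp .snd))
      have e2 : Primrec fun a : α × ℕ => (a.1, a.2.unpair.2) :=
        Primrec.fst.pair (Primrec.snd.comp (Primrec.unpair.comp .snd))
      refine ⟨_, (ih (hp'.comp e1) (hq'.comp e2)).2, fun a => ?_⟩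
      change p a ∧ q a ↔ _
      rw [h1, h2]
      constructor
      · rintro ⟨⟨x, hx⟩, y, hy⟩
        exact ⟨Nat.pair x y, by simp [hx, hy]⟩
      · rintro ⟨x, hx⟩
        rw [not_or] at hx
        exact ⟨⟨_, hx.1⟩, _, hx.2⟩
    · refine ⟨_, (ih hp' hq').1, fun a => ?_⟩
      change p a ∨ q a ↔ _
      rw [h1, h2, ← exists_or]
      exact exists_congr fun x => by tauto

theorem and {p q : α → Prop} (hp : SigmaPred m α p) (hq : SigmaPred m α q) :
    SigmaPred m α fun a => p a ∧ q a :=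
  (and_or hp hq).1

theorem or {p q : α → Prop} (hp : SigmaPred m α p) (hq : SigmaPred m α q) :
    SigmaPred m α fun a => p a ∨ q a :=
  (and_or hp hq).2

theorem exists_nat {p : α × ℕ → Prop} (hp : SigmaPred (m + 1) (α × ℕ) p) :
    SigmaPred (m + 1) α fun a => ∃ x, p (a, x) := by
  obtain ⟨q, hq, h⟩ := hp
  have e : Primrec fun a : α × ℕ => ((a.1, a.2.unpair.1), a.2.unpair.2) :=
    (Primrec.fst.pair (Primrec.fst.comp (Primrec.unpair.comp .snd))).pair
      (Primrec.snd.comp (Primrec.unpair.comp .snd))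
  refine ⟨_, hq.comp e, fun a => ?_⟩
  constructor
  · rintro ⟨x, hx⟩
    obtain ⟨y, hy⟩ := (h _).1 hx
    exact ⟨Nat.pair x y, by simpa using hy⟩
  · rintro ⟨x, hx⟩
    exact ⟨_, (h _).2 ⟨_, hx⟩⟩

/-- Numbers that code nothing are read as the default element, which adds no false witnesses. This
allows quantifiers over words and lists of words. -/
theorem exists_of [Inhabited β] {p : α → β → Prop}
    (hp : SigmaPred (m + 1) (α × β) fun a => p a.1 a.2) :
    SigmaPred (m + 1) α fun a => ∃ x, p a x := by
  have e : Primrec fun a : α × ℕ => (a.1, (Encodable.decode (α := β) a.2).getD default) :=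
    Primrec.fst.pair (Primrec.option_getD.comp (Primrec.decode.comp .snd) (.const _))
  refine (exists_nat (hp.comp e)).of_eq fun a => ⟨fun ⟨x, hx⟩ => ⟨_, hx⟩, fun ⟨x, hx⟩ => ?_⟩
  exact ⟨Encodable.encode x, by simpa using hx⟩

theorem of_primrec {p : α → Prop} (hp : PrimrecPred p) : SigmaPred m α p :=
  mono (m := 0) hp (Nat.zero_le m)

theorem of_not_forall [Inhabited β] {p : α → β → Prop}
    (hp : PrimrecPred fun a : α × β => p a.1 a.2) : SigmaPred 1 α fun a => ¬ ∀ x, p a x :=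
  (exists_of (p := fun a x => ¬ p a x) (of_primrec hp.not)).of_eq fun a => by simp

end SigmaPred

theorem altQuant_not (b : Bool) (m : ℕ) (R : List.Vector ℕ m → Prop) :
    altQuant b m (fun v => ¬ R v) ↔ ¬ altQuant (!b) m R := by
  induction m generalizing b with
  | zero => simp [altQuant]
  | succ m ih => cases b <;> simp [altQuant, ih]

theorem SigmaPred.isSigma {α : Type} [Primcodable α] {m : ℕ} {A : Set α}
    (h : SigmaPred m α fun a => a ∈ A) : IsSigma m A := by
  induction m generalizing α with
  | zero =>
    exact ⟨fun a => a.1 ∈ A, (PrimrecPred.comp h .fst).computablePred, fun a => Iff.rfl⟩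
  | succ m ih =>
    obtain ⟨q, hq, h⟩ := h
    obtain ⟨P, hP, hPq⟩ := ih (A := {a | q a}) hq
    have e : Primrec fun a : α × List.Vector ℕ (m + 1) => ((a.1, a.2.head), a.2.tail) :=
      (Primrec.fst.pair (Primrec.vector_head.comp .snd)).pair (Primrec.vector_tail.comp .snd)
    refine ⟨fun a => ¬ P ((a.1, a.2.head), a.2.tail), ?_, fun a => ?_⟩
    · obtain ⟨f, hf, rfl⟩ := ComputablePred.computable_iff.1 hP
      exact ComputablePred.not (ComputablePred.computable_iff.2 ⟨_, hf.comp e.to_comp, rfl⟩)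
    · refine (h a).trans (exists_congr fun x => ?_)
      -- Pushing the negation through the prefix dualizes all its quantifiers, so the alternation
      -- continues correctly after `∃ x`.
      exact (not_congr (hPq (a, x))).trans (altQuant_not false m _).symm

attribute [irreducible] SigmaPred


/-! ### Primitive recursive predicates with bounded quantifiers -/

section Primrec

variable {α β γ : Type} [Primcodable α] [Primcodable β] [Primcodable γ]

theorem PrimrecPred.exists_mem {l : α → List β} {p : α → β → Prop} (hl : Primrec l)
    (hp : PrimrecPred fun x : α × β => p x.1 x.2) : PrimrecPred fun a => ∃ b ∈ l a, p a b := by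
  have h : PrimrecRel fun (b : β) (a : α) => p a b :=
    PrimrecPred.primrecRel (p := fun x : β × α => p x.2 x.1)
      (PrimrecPred.comp (f := fun x : β × α => (x.2, x.1)) hp (Primrec.snd.pair .fst))
  exact PrimrecRel.comp h.exists_mem_list hl .id

theorem PrimrecPred.forall_mem {l : α → List β} {p : α → β → Prop} (hl : Primrec l)
    (hp : PrimrecPred fun x : α × β => p x.1 x.2) : PrimrecPred fun a => ∀ b ∈ l a, p a b := by
  have h : PrimrecRel fun (b : β) (a : α) => p a b :=
    PrimrecPred.primrecRel (p := fun x : β × α => p x.2 x.1)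
      (PrimrecPred.comp (f := fun x : β × α => (x.2, x.1)) hp (Primrec.snd.pair .fst))
  exact PrimrecRel.comp h.forall_mem_list hl .id

theorem Primrec.filter {l : α → List β} {p : α → β → Prop} [∀ a, DecidablePred (p a)]
    (hl : Primrec l) (hp : PrimrecPred fun x : α × β => p x.1 x.2) :
    Primrec fun a => (l a).filter (p a ·) := by
  have h : PrimrecRel fun (b : β) (a : α) => p a b :=
    PrimrecPred.primrecRel (p := fun x : β × α => p x.2 x.1)
      (PrimrecPred.comp (f := fun x : β × α => (x.2, x.1)) hp (Primrec.snd.pair .fst))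
  exact Primrec₂.comp (f := fun (L : List β) a => L.filter (p a ·)) h.listFilter hl .id

/-- The list of all elements with code at most `c`. -/
def codesLE (β : Type) [Primcodable β] (c : ℕ) : List β :=
  (List.range (c + 1)).filterMap (Encodable.decode₂ β)

theorem mem_codesLE {c : ℕ} {b : β} : b ∈ codesLE β c ↔ Encodable.encode b ≤ c := by
  simp only [codesLE, List.mem_filterMap, List.mem_range, Encodable.decode₂_eq_some]
  constructor
  · rintro ⟨n, hn, rfl⟩
    omega
  · exact fun h => ⟨_, by omega, rfl⟩

/-- `decode₂` accepts only the true code of an element, so nothing is listed twice and lengths of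
filtered lists are cardinalities. -/
theorem nodup_codesLE (c : ℕ) : (codesLE β c).Nodup := by
  refine List.Nodup.filterMap (fun a a' b h h' => ?_) List.nodup_range
  rw [Option.mem_def, Encodable.decode₂_eq_some] at h h'
  exact h.symm.trans h'

theorem primrec_codesLE : Primrec (codesLE β) :=
  Primrec.listFilterMap (Primrec.list_range.comp Primrec.succ) (Primrec.decode₂.comp .snd).to₂

/-- A bound for the codes of words of length at most `n` over letters with codes at most `B`. -/
def codeBound (B n : ℕ) : ℕ :=
  Nat.rec 0 (fun _ c => Nat.pair B c + 1) n

theorem primrec_codeBound : Primrec₂ codeBound :=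
  Primrec.nat_rec (.const 0) (Primrec.succ.comp (Primrec₂.natPair.comp .fst
    (Primrec.snd.comp .snd))).to₂

theorem pair_le_pair {a b c d : ℕ} (h : a ≤ b) (h' : c ≤ d) : Nat.pair a c ≤ Nat.pair b d :=
  ((StrictMono.monotone fun _ _ h => Nat.pair_lt_pair_left c h) h).trans
    ((StrictMono.monotone fun _ _ h => Nat.pair_lt_pair_right b h) h')

theorem encode_le_codeBound {B n : ℕ} {w : List β} (h : w.length ≤ n)
    (hB : ∀ b ∈ w, Encodable.encode b ≤ B) : Encodable.encode w ≤ codeBound B n := by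
  induction w generalizing n with
  | nil => simp
  | cons a w ih =>
    obtain _ | n := n
    · simp at h
    · rw [Encodable.encode_list_cons]
      exact Nat.succ_le_succ (pair_le_pair (hB _ (by simp))
        (ih (by simpa using h) fun b hb => hB _ (by simp [hb])))

end Primrec

/-! ### Pumping -/

section Pump

variable {β : Type}

/-- The quotients of `S` by words of length at least `s` are classified by `N` colours. -/
def PumpAt (S : Set (List β)) (s N : ℕ) : Prop :=
  ∃ (σ : Type) (_ : Fintype σ) (f : List β → σ), Fintype.card σ ≤ N ∧
    ∀ x y, s ≤ x.length → s ≤ y.length → f x = f y → ∀ z, x ++ z ∈ S ↔ y ++ z ∈ S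

variable {S T : Set (List β)} {s t N M : ℕ}

theorem PumpAt.mono (h : PumpAt S s N) (hs : s ≤ t) (hN : N ≤ M) : PumpAt S t M := by
  obtain ⟨σ, _, f, hf, h⟩ := h
  exact ⟨σ, _, f, hf.trans hN, fun x y hx hy => h x y (hs.trans hx) (hs.trans hy)⟩

theorem PumpAt.compl (h : PumpAt S s N) : PumpAt Sᶜ s N := by
  obtain ⟨σ, _, f, hf, h⟩ := h
  exact ⟨σ, _, f, hf, fun x y hx hy hxy z => not_congr (h x y hx hy hxy z)⟩

theorem PumpAt.inter (h : PumpAt S s N) (h' : PumpAt T s M) : PumpAt (S ∩ T) s (N * M) := by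
  obtain ⟨σ, _, f, hf, h⟩ := h
  obtain ⟨σ', _, f', hf', h'⟩ := h'
  refine ⟨σ × σ', inferInstance, fun w => (f w, f' w), ?_, fun x y hx hy hxy z => ?_⟩
  · rw [Fintype.card_prod]
    exact Nat.mul_le_mul hf hf'
  · rw [Prod.mk.injEq] at hxy
    exact and_congr (h x y hx hy hxy.1 z) (h' x y hx hy hxy.2 z)

/-- Pigeonhole on the `N + 1` prefixes of lengths `s` to `s + N`: two of the same colour have the
same quotient, so the factor between them can be deleted or repeated. -/
theorem PumpAt.exists_split (h : PumpAt S s N) {w : List β} (hw : w ∈ S) (hl : s + N ≤ w.length) :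
    ∃ x y z, w = x ++ y ++ z ∧ 0 < y.length ∧ y.length ≤ N ∧
      ∀ k, x ++ (List.replicate k y).flatten ++ z ∈ S := by
  obtain ⟨σ, _, f, hf, h⟩ := h
  obtain ⟨i, j, hij, hfij⟩ := Fintype.exists_ne_map_eq_of_card_lt
    (fun i : Fin (N + 1) => f (w.take (s + i))) (by simp; omega)
  wlog hlt : i < j generalizing i j
  · exact this j i hij.symm hfij.symm (lt_of_le_of_ne (not_lt.1 hlt) hij.symm)
  have hlt' : (i : ℕ) < j := hlt
  have hj := j.2
  have e : w.take (s + j) = w.take (s + i) ++ (w.drop (s + i)).take (j - i) := by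
    rw [← List.take_add]
    congr 1
    omega
  refine ⟨w.take (s + i), (w.drop (s + i)).take (j - i), w.drop (s + j), ?_, ?_, ?_, fun k => ?_⟩
  · rw [← e, List.take_append_drop]
  · simp
    omega
  · simp
    omega
  · have key : ∀ z, w.take (s + i) ++ z ∈ S ↔
        w.take (s + i) ++ ((w.drop (s + i)).take (j - i) ++ z) ∈ S := fun z => by
      rw [← List.append_assoc, ← e]
      exact h _ _ (by simp; omega) (by simp; omega) hfij z
    rw [List.append_assoc]
    induction k with
    | zero =>
      simp only [List.replicate_zero, List.flatten_nil, List.nil_append]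
      rw [key, ← List.append_assoc, ← e, List.take_append_drop]
      exact hw
    | succ k ih =>
      rw [List.replicate_succ, List.flatten_cons, List.append_assoc]
      exact (key _).1 ih

theorem PumpAt.infinite (h : PumpAt S s N) {w : List β} (hw : w ∈ S) (hl : s + N ≤ w.length) :
    S.Infinite := by
  obtain ⟨x, y, z, -, hy, -, hk⟩ := h.exists_split hw hl
  refine Set.infinite_of_injective_forall_mem (f := fun k => x ++ (List.replicate k y).flatten ++ z)
    (fun k l hkl => ?_) hk
  have := congrArg List.length hkl
  simp only [List.length_append, List.length_flatten, List.map_replicate, List.sum_replicate,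
    smul_eq_mul] at this
  exact Nat.eq_of_mul_eq_mul_right hy (by omega)

/-- Deleting a factor of length at most `N` from a word of length at least `s + 2 * N` never goes
below `s + N`. -/
theorem PumpAt.exists_lt (h : PumpAt S s N) {w : List β} (hw : w ∈ S) (hl : s + N ≤ w.length) :
    ∃ w' ∈ S, s + N ≤ w'.length ∧ w'.length < s + 2 * N := by
  induction hn : w.length using Nat.strong_induction_on generalizing w with
  | _ n ih =>
    subst hn
    by_cases hlt : w.length < s + 2 * N
    · exact ⟨w, hw, hl, hlt⟩
    · obtain ⟨x, y, z, rfl, hy, hyN, hk⟩ := h.exists_split hw hl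
      have := hk 0
      simp only [List.replicate_zero, List.flatten_nil, List.append_nil] at this
      simp only [List.length_append] at hlt ih
      exact ih _ (by simp; omega) this (by simp; omega) rfl

theorem finite_of_bounded [Encodable β] {B n : ℕ} (hB : ∀ w ∈ S, ∀ b ∈ w, Encodable.encode b ≤ B)
    (hn : ∀ w ∈ S, w.length ≤ n) : S.Finite := by
  have hf : {b : β | Encodable.encode b ≤ B}.Finite :=
    Set.Finite.preimage Encodable.encode_injective.injOn (Set.finite_Iic B)
  have : Finite {b : β // Encodable.encode b ≤ B} := hf.to_subtype
  refine ((List.finite_length_le {b : β // Encodable.encode b ≤ B} n).image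
    (List.map Subtype.val)).subset fun w hw => ?_
  exact ⟨w.attachWith _ (hB w hw), by simpa using hn w hw, by simp⟩

end Pump

/-! ### Counting words -/

/-- The cardinality represented by an optional number, where `none` represents `∞`. -/
def toENat (o : Option ℕ) : ℕ∞ :=
  o.elim ⊤ fun n => (n : ℕ∞)

theorem toENat_injective : Function.Injective toENat := by
  rintro (_ | m) (_ | n) h <;> simp_all [toENat]

theorem exists_toENat (c : ℕ∞) : ∃ o, toENat o = c := by
  induction c using ENat.recTopCoe with
  | top => exact ⟨none, rfl⟩
  | coe n => exact ⟨some n, rfl⟩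

open Classical in
theorem exists_primrec_encard {α β : Type} [Primcodable α] [Primcodable β] {p : α → List β → Prop}
    {B s N : α → ℕ} (hp : PrimrecPred fun x : α × List β => p x.1 x.2) (hB : Primrec B)
    (hs : Primrec s) (hN : Primrec N) :
    ∃ C : α → Option ℕ, Primrec C ∧ ∀ a, (∀ w, p a w → ∀ b ∈ w, Encodable.encode b ≤ B a) →
      PumpAt {w | p a w} (s a) (N a) → toENat (C a) = {w | p a w}.encard := by
  let L : α → List (List β) := fun a => codesLE (List β) (codeBound (B a) (s a + 2 * N a))
  have hL : Primrec L := primrec_codesLE.comp (primrec_codeBound.comp hB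
    (Primrec.nat_add.comp hs (Primrec.nat_double.comp hN)))
  have hq : PrimrecPred fun a => ∃ w ∈ L a, s a + N a ≤ w.length ∧ p a w :=
    PrimrecPred.exists_mem hL (PrimrecPred.and (Primrec.nat_le.comp
      (Primrec.nat_add.comp (hs.comp .fst) (hN.comp .fst)) (Primrec.list_length.comp .snd)) hp)
  -- The search is total; the bounds on letters and colours are needed only for the correctness of
  -- its answer at a given `a`.
  refine ⟨fun a => if ∃ w ∈ L a, s a + N a ≤ w.length ∧ p a w then none else
    some ((L a).filter (p a ·)).length, Primrec.ite hq (.const _) (Primrec.option_some.comp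
      (Primrec.list_length.comp (Primrec.filter hL hp))), fun a hBa hPa => ?_⟩
  have hmem : ∀ w, p a w → w.length ≤ s a + 2 * N a → w ∈ L a := fun w hw hl =>
    mem_codesLE.2 (encode_le_codeBound hl (hBa w hw))
  beta_reduce
  split_ifs with h
  · obtain ⟨w, -, hl, hw⟩ := h
    exact (Set.encard_eq_top (hPa.infinite hw hl)).symm
  · have hlt : ∀ w, p a w → w.length < s a + N a := by
      intro w hw
      by_contra hl
      obtain ⟨w', hw', h1, h2⟩ := hPa.exists_lt hw (not_lt.1 hl)
      exact h ⟨w', hmem w' hw' h2.le, h1, hw'⟩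
    have e : {w | p a w} = ((L a).filter (p a ·)).toFinset := by
      ext w
      simp only [Set.mem_ofPred_eq, List.coe_toFinset, List.mem_filter, decide_eq_true_eq]
      exact ⟨fun hw => ⟨hmem w hw (by have := hlt w hw; omega), hw⟩, fun hw => hw.2⟩
    rw [e, Set.encard_coe_eq_coe_finsetCard,
      List.toFinset_card_of_nodup ((nodup_codesLE _).filter _)]
    rfl

theorem primrecPred_exists_word {α β : Type} [Primcodable α] [Primcodable β]
    {p : α → List β → Prop} {B s N : α → ℕ} (hp : PrimrecPred fun x : α × List β => p x.1 x.2)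
    (hB : Primrec B) (hs : Primrec s) (hN : Primrec N)
    (hpB : ∀ a w, p a w → ∀ b ∈ w, Encodable.encode b ≤ B a)
    (hpN : ∀ a, PumpAt {w | p a w} (s a) (N a)) : PrimrecPred fun a => ∃ w, p a w := by
  obtain ⟨C, hC, h⟩ := exists_primrec_encard hp hB hs hN
  refine (PrimrecPred.not (Primrec.eq.comp hC (.const (some 0)))).of_eq fun a => ?_
  rw [← toENat_injective.eq_iff, h a (hpB a) (hpN a)]
  simp [toENat, Set.eq_empty_iff_forall_notMem]


theorem encode_le_of_mem {β : Type} [Primcodable β] {b : β} {l : List β} (h : b ∈ l) :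
    Encodable.encode b ≤ Encodable.encode l := by
  induction l with
  | nil => simp at h
  | cons a l ih =>
    rw [Encodable.encode_list_cons]
    rcases List.mem_cons.1 h with rfl | h
    · exact (Nat.left_le_pair _ _).trans (Nat.le_succ _)
    · exact (ih h).trans ((Nat.right_le_pair _ _).trans (Nat.le_succ _))

theorem primrec_pow : Primrec₂ fun a b : ℕ => a ^ b :=
  Primrec₂.unpaired'.1 Nat.Primrec.pow

/-! ### Languages of finite automata -/

namespace FinAut

variable {α : Type}

theorem primrec_trans [Primcodable α] : Primrec (FinAut.trans (α := α)) :=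
  Primrec.fst.comp (Primrec.of_equiv (e := FinAut.equivProd α))

theorem primrec_init [Primcodable α] : Primrec (FinAut.init (α := α)) :=
  Primrec.fst.comp (Primrec.snd.comp (Primrec.of_equiv (e := FinAut.equivProd α)))

theorem primrec_final [Primcodable α] : Primrec (FinAut.final (α := α)) :=
  Primrec.snd.comp (Primrec.snd.comp (Primrec.of_equiv (e := FinAut.equivProd α)))

open Classical in
/-- The states reached from the states of the list `S` by the letter `a`. -/
noncomputable def next (A : FinAut α) (S : List ℕ) (a : α) : List ℕ :=
  (A.trans.filter fun t => t.1 ∈ S ∧ t.2.1 = a).map fun t => t.2.2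

theorem mem_next {A : FinAut α} {S : List ℕ} {a : α} {q : ℕ} :
    q ∈ A.next S a ↔ ∃ p ∈ S, (p, a, q) ∈ A.trans := by
  simp only [next, List.mem_map, List.mem_filter, decide_eq_true_eq, Prod.exists]
  constructor
  · rintro ⟨p, b, _, ⟨h, hp, rfl⟩, rfl⟩
    exact ⟨p, hp, h⟩
  · rintro ⟨p, hp, h⟩
    exact ⟨p, a, q, ⟨h, hp, rfl⟩, rfl⟩

theorem mem_foldl_next {A : FinAut α} {S : List ℕ} {T : Set ℕ} (h : ∀ q, q ∈ S ↔ q ∈ T)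
    (w : List α) (q : ℕ) : q ∈ w.foldl A.next S ↔ q ∈ A.toNFA.evalFrom T w := by
  induction w generalizing S T with
  | nil => exact h q
  | cons a w ih =>
    refine ih fun q => ?_
    simp only [mem_next, NFA.mem_stepSet, h]
    rfl

theorem mem_language {A : FinAut α} {w : List α} :
    w ∈ A.language ↔ ∃ q ∈ A.final, q ∈ w.foldl A.next A.init := by
  simp only [mem_foldl_next (T := {q | q ∈ A.init}) (fun q => Iff.rfl)]
  rfl

theorem primrecPred_mem_language [Primcodable α] :
    PrimrecPred fun x : FinAut α × List α => x.2 ∈ x.1.language := by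
  classical
  have hfilter : Primrec fun x : (FinAut α × List α) × List ℕ × α =>
      x.1.1.next x.2.1 x.2.2 := by
    refine Primrec.list_map (Primrec.filter (primrec_trans.comp (Primrec.fst.comp .fst))
      (PrimrecPred.and ?_ ?_)) (Primrec.snd.comp (Primrec.snd.comp .snd)).to₂
    · exact (PrimrecPred.exists_mem (p := fun (x : _ × ℕ × α × ℕ) b => x.2.1 = b)
        (Primrec.fst.comp (Primrec.snd.comp .fst)) (Primrec.eq.comp
          (Primrec.fst.comp (Primrec.snd.comp .fst)) .snd)).of_eq fun a => by simp
    · exact Primrec.eq.comp (Primrec.fst.comp (Primrec.snd.comp .snd))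
        (Primrec.snd.comp (Primrec.snd.comp .fst))
  have hrun : Primrec fun x : FinAut α × List α => x.2.foldl x.1.next x.1.init :=
    Primrec.list_foldl .snd (primrec_init.comp .fst) hfilter.to₂
  refine (PrimrecPred.exists_mem (p := fun (x : FinAut α × List α) q =>
    ∃ q' ∈ x.2.foldl x.1.next x.1.init, q = q') (primrec_final.comp .fst)
    (PrimrecPred.exists_mem (hrun.comp .fst)
      (Primrec.eq.comp (Primrec.snd.comp .fst) .snd))).of_eq fun x => ?_
  simp [mem_language]

/-- A bound for the codes of the letters of an automaton. -/
def letterBound [Primcodable α] (A : FinAut α) : ℕ :=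
  Encodable.encode (A.trans.map fun t => t.2.1)

theorem primrec_letterBound [Primcodable α] : Primrec (letterBound (α := α)) :=
  Primrec.encode.comp (Primrec.list_map primrec_trans
    (Primrec.fst.comp (Primrec.snd.comp .snd)).to₂)

/-- Nothing is reached from the empty set of states, so every letter of an accepted word labels some
transition. -/
theorem encode_le_letterBound [Primcodable α] {A : FinAut α} {w : List α} (hw : w ∈ A.language) {a : α}
    (ha : a ∈ w) : Encodable.encode a ≤ A.letterBound := by
  obtain ⟨q, -, hq⟩ := mem_language.1 hw
  clear hw
  generalize A.init = S at hq
  have hnil : ∀ v : List α, v.foldl A.next [] = [] := fun v => by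
    induction v with
    | nil => rfl
    | cons b v ih => simpa [next] using ih
  induction w generalizing S with
  | nil => simp at ha
  | cons b w ih =>
    rw [List.foldl_cons] at hq
    rcases List.mem_cons.1 ha with rfl | ha'
    · obtain h | ⟨q', hq'⟩ : A.next S a = [] ∨ ∃ q', q' ∈ A.next S a := by
        rcases A.next S a with _ | ⟨q', l⟩ <;> simp
      · simp [h, hnil] at hq
      · obtain ⟨p, -, hp⟩ := mem_next.1 hq'
        exact encode_le_of_mem (List.mem_map.2 ⟨_, hp, rfl⟩)
    · exact ih ha' _ hq

/-- A bound for the number of state sets of an automaton. -/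
def stateBound (A : FinAut α) : ℕ :=
  2 ^ (A.init.length + A.trans.length)

theorem primrec_stateBound [Primcodable α] : Primrec (stateBound (α := α)) := by
  exact primrec_pow.comp (.const 2) (Primrec.nat_add.comp (Primrec.list_length.comp primrec_init)
    (Primrec.list_length.comp primrec_trans))

/-- The colour of a word is the set of states it reaches. All of these are initial states or targets
of transitions, whence the exponent in `stateBound`. -/
theorem pumpAt_language (A : FinAut α) (s : ℕ) : PumpAt A.language s A.stateBound := by
  let l : List ℕ := A.init ++ A.trans.map fun t => t.2.2
  have hl : ∀ w : List α, ∀ q ∈ w.foldl A.next A.init, q ∈ l := by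
    intro w q hq
    rcases List.eq_nil_or_concat w with rfl | ⟨w, a, rfl⟩
    · exact List.mem_append_left _ hq
    · rw [List.concat_eq_append, List.foldl_append] at hq
      obtain ⟨p, -, hp⟩ := mem_next.1 hq
      exact List.mem_append_right _ (List.mem_map.2 ⟨_, hp, rfl⟩)
  classical
  refine ⟨Set {q // q ∈ l.toFinset}, inferInstance,
    fun w => {q | q.1 ∈ w.foldl A.next A.init}, ?_, fun x y _ _ hxy z => ?_⟩
  · rw [Fintype.card_set, Fintype.card_coe]
    refine Nat.pow_le_pow_right two_pos ((List.toFinset_card_le l).trans ?_)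
    simp [l]
  · have hmem : ∀ q, q ∈ x.foldl A.next A.init ↔ q ∈ y.foldl A.next A.init := fun q => by
      constructor <;> intro hq
      · exact (Set.ext_iff.1 hxy ⟨q, List.mem_toFinset.2 (hl _ _ hq)⟩).1 hq
      · exact (Set.ext_iff.1 hxy ⟨q, List.mem_toFinset.2 (hl _ _ hq)⟩).2 hq
    change x ++ z ∈ A.language ↔ y ++ z ∈ A.language
    simp only [mem_language, List.foldl_append]
    rw [exists_congr fun q => and_congr_right fun _ => ?_]
    rw [mem_foldl_next (T := {q | q ∈ y.foldl A.next A.init}) hmem,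
      mem_foldl_next (T := {q | q ∈ y.foldl A.next A.init}) fun _ => Iff.rfl]

end FinAut

/-! ### Words with a given projection -/

/-- The first `n` symbols of the word `y`, padded with `none`. -/
def pad {α : Type} (y : List α) (n : ℕ) : List (Option α) :=
  (List.range n).map fun i => y[i]?

theorem primrec_pad {α : Type} [Primcodable α] : Primrec₂ (pad (α := α)) :=
  Primrec.list_map (Primrec.list_range.comp .snd)
    (Primrec.list_getElem?.comp (Primrec.fst.comp .fst) .snd).to₂

section Fiber

variable {α β : Type}

@[simp]
theorem length_pad (y : List α) (n : ℕ) : (pad y n).length = n := by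
  simp [pad]

theorem pad_append (y z : List α) (n : ℕ) :
    pad (y ++ z) (y.length + n) = y.map some ++ pad z n := by
  refine List.ext_getElem (by simp) fun i h1 h2 => ?_
  by_cases h : i < y.length
  · rw [List.getElem_append_left (by simpa using h)]
    simp [pad, List.getElem?_append_left h, h]
  · rw [List.getElem_append_right (by simpa using h)]
    simp [pad, List.getElem?_append_right (not_lt.1 h)]

theorem pad_of_le {y : List α} {n m : ℕ} (h : y.length ≤ n) :
    pad y (n + m) = pad y n ++ List.replicate m none := by
  refine List.ext_getElem (by simp) fun i h1 h2 => ?_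
  by_cases h : i < n
  · rw [List.getElem_append_left (by simpa using h)]
    simp [pad]
  · rw [List.getElem_append_right (by simpa using h)]
    simp [pad]
    omega

theorem pad_injective {y z : List α} {n : ℕ} (hy : y.length ≤ n) (hz : z.length ≤ n)
    (h : pad y n = pad z n) : y = z := by
  refine List.ext_getElem? fun i => ?_
  by_cases hi : i < n
  · have := congrArg (fun l => l[i]?) h
    simpa [pad, hi] using this
  · rw [List.getElem?_eq_none (by omega), List.getElem?_eq_none (by omega)]

/-- The words of `L` that project to the word `y`, padded by at least `m` symbols. -/
def fiber (L : Set (List β)) (π : β → Option α) (m : ℕ) (y : List α) : Set (List β) :=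
  {w | w ∈ L ∧ y.length + m ≤ w.length ∧ w.map π = pad y w.length}

variable {L : Set (List β)} {π : β → Option α} {m s N : ℕ}

theorem append_mem_fiber {x y : List α} {v w : List β} (h : v.length = x.length) :
    v ++ w ∈ fiber L π m (x ++ y) ↔ v.map π = x.map some ∧ w ∈ fiber {w | v ++ w ∈ L} π m y := by
  have e : (v ++ w).map π = pad (x ++ y) (v ++ w).length ↔
      v.map π = x.map some ∧ w.map π = pad y w.length := by
    rw [List.length_append, h, pad_append, List.map_append]
    exact ⟨fun h' => List.append_inj h' (by simp [h]), fun h' => by rw [h'.1, h'.2]⟩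
  have e' : (x ++ y).length + m ≤ (v ++ w).length ↔ y.length + m ≤ w.length := by
    simp only [List.length_append]
    omega
  unfold fiber
  rw [Set.mem_ofPred_eq, Set.mem_ofPred_eq, e, e', Set.mem_ofPred_eq]
  tauto

theorem take_mem_fiber {x y : List α} {w : List β} (h : w ∈ fiber L π m (x ++ y)) :
    (w.take x.length).map π = x.map some ∧
      w.drop x.length ∈ fiber {z | w.take x.length ++ z ∈ L} π m y := by
  have hl : (w.take x.length).length = x.length := by
    have := h.2.1
    simp only [List.length_append] at this
    simp
    omega
  rw [← append_mem_fiber hl, List.take_append_drop]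
  exact h

/-- Among `k` words above `x ++ z`, the prefixes above `x` are replaced injectively by words above
`y` of the same colour. Equal colours keep the words in `L`, and at most `k` prefixes of each colour
occur, so counts truncated at `k` suffice. -/
theorem le_encard_fiber {σ : Type} {f : List β → σ}
    (hf : ∀ v w, f v = f w → ∀ z, v ++ z ∈ L ↔ w ++ z ∈ L) {k : ℕ} {x y : List α}
    (h : ∀ i, min (k : ℕ∞) {w | w.map π = x.map some ∧ f w = i}.encard =
      min (k : ℕ∞) {w | w.map π = y.map some ∧ f w = i}.encard) {z : List α}
    (hk : k ≤ (fiber L π m (x ++ z)).encard) : k ≤ (fiber L π m (y ++ z)).encard := by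
  obtain ⟨F, hF, hFk⟩ := Set.exists_subset_encard_eq hk
  have hfin : F.Finite := Set.finite_of_encard_eq_coe hFk
  let P : σ → Set (List β) := fun i => {v | v ∈ (List.take x.length) '' F ∧ f v = i}
  have hg : ∀ i, ∃ g : List β → List β, P i ⊆ g ⁻¹' {w | w.map π = y.map some ∧ f w = i} ∧
      Set.InjOn g (P i) := by
    intro i
    have hP : P i ⊆ List.take x.length '' F := fun v hv => hv.1
    refine Set.Finite.exists_injOn_of_encard_le ((hfin.image _).subset hP) ?_
    refine le_trans (le_min ?_ (Set.encard_le_encard ?_)) ((h i).le.trans (min_le_right _ _))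
    · exact (Set.encard_le_encard hP).trans ((Set.encard_image_le _ _).trans hFk.le)
    · rintro v ⟨⟨w, hw, rfl⟩, hv⟩
      exact ⟨(take_mem_fiber (hF hw)).1, hv⟩
  choose g hg hginj using hg
  let G : List β → List β := fun w =>
    g (f (w.take x.length)) (w.take x.length) ++ w.drop x.length
  have hGP : ∀ w ∈ F, (g (f (w.take x.length)) (w.take x.length)).map π = y.map some ∧
      f (g (f (w.take x.length)) (w.take x.length)) = f (w.take x.length) := fun w hw =>
    hg _ ⟨⟨w, hw, rfl⟩, rfl⟩
  have hGl : ∀ w ∈ F, (g (f (w.take x.length)) (w.take x.length)).length = y.length := fun w hw => by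
    simpa using congrArg List.length (hGP w hw).1
  rw [← hFk]
  refine Set.encard_le_encard_of_injOn (f := G) (fun w hw => ?_) fun v hv w hw hvw => ?_
  · refine (append_mem_fiber (hGl w hw)).2 ⟨(hGP w hw).1, ?_⟩
    have e : {z | g (f (w.take x.length)) (w.take x.length) ++ z ∈ L} =
        {z | w.take x.length ++ z ∈ L} := by
      ext z
      exact hf _ _ (hGP w hw).2 z
    rw [e]
    exact (take_mem_fiber (hF hw)).2
  · obtain ⟨h1, h2⟩ := List.append_inj hvw ((hGl v hv).trans (hGl w hw).symm)
    have h3 : f (v.take x.length) = f (w.take x.length) := by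
      rw [← (hGP v hv).2, ← (hGP w hw).2, h1]
    rw [h3] at h1
    have h4 := hginj _ ⟨⟨v, hv, rfl⟩, h3⟩ ⟨⟨w, hw, rfl⟩, rfl⟩ h1
    rw [← List.take_append_drop x.length v, h4, h2, List.take_append_drop]

/-- The colour of `y` is the vector, indexed by the colours of `L`, of the numbers of words above
`y`, truncated at `k`. -/
theorem PumpAt.le_encard_fiber (h : PumpAt L 0 N) (k : ℕ) :
    PumpAt {y | k ≤ (fiber L π m y).encard} s ((k + 1) ^ N) := by
  obtain ⟨σ, _, f, hσ, hf⟩ := h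
  classical
  have hlt : ∀ c : ℕ∞, (min (k : ℕ∞) c).toNat < k + 1 := fun c => by
    have := ENat.toNat_le_toNat (min_le_left (k : ℕ∞) c) (ENat.natCast_ne_top k)
    rw [ENat.toNat_natCast] at this
    omega
  refine ⟨σ → Fin (k + 1), inferInstance,
    fun y i => ⟨_, hlt {w | w.map π = y.map some ∧ f w = i}.encard⟩, ?_, fun x y _ _ hxy z => ?_⟩
  · rw [Fintype.card_fun, Fintype.card_fin]
    exact Nat.pow_le_pow_right (Nat.succ_pos k) hσ
  · have h : ∀ i, min (k : ℕ∞) {w | w.map π = x.map some ∧ f w = i}.encard =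
        min (k : ℕ∞) {w | w.map π = y.map some ∧ f w = i}.encard := fun i => by
      have := Fin.ext_iff.1 (congrFun hxy i)
      have hne : ∀ c : ℕ∞, min (k : ℕ∞) c ≠ ⊤ := fun c =>
        ne_top_of_le_ne_top (ENat.natCast_ne_top k) (min_le_left _ _)
      rw [← ENat.natCast_toNat (hne _),
        ← ENat.natCast_toNat (hne {w | w.map π = y.map some ∧ f w = i}.encard)]
      exact congrArg _ this
    have hf' : ∀ v w, f v = f w → ∀ z, v ++ z ∈ L ↔ w ++ z ∈ L := fun v w =>
      hf v w (Nat.zero_le _) (Nat.zero_le _)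
    exact ⟨AutomaticTrees.le_encard_fiber hf' h,
      AutomaticTrees.le_encard_fiber hf' fun i => (h i).symm⟩

/-- Beyond the length of `y` only padding may follow, so besides the colour for `L` one bit
suffices: whether the prefix projects correctly. -/
theorem PumpAt.fiber (h : PumpAt L 0 N) (y : List α) :
    PumpAt (fiber L π 0 y) y.length (N * 2) := by
  obtain ⟨σ, _, f, hσ, hf⟩ := h
  classical
  refine ⟨σ × Bool, inferInstance, fun w => (f w, decide (w.map π = pad y w.length)), ?_,
    fun v w hv hw hvw z => ?_⟩
  · rw [Fintype.card_prod, Fintype.card_bool]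
    exact Nat.mul_le_mul_right _ hσ
  · have e : ∀ v : List β, y.length ≤ v.length → (v ++ z ∈ AutomaticTrees.fiber L π 0 y ↔
        v ++ z ∈ L ∧ v.map π = pad y v.length ∧ z.map π = List.replicate z.length none) := by
      intro v hv
      refine and_congr_right fun _ => ?_
      rw [List.length_append, pad_of_le hv, List.map_append]
      exact ⟨fun h => List.append_inj h.2 (by simp), fun h => ⟨by omega, by rw [h.1, h.2]⟩⟩
    rw [Prod.mk.injEq, decide_eq_decide] at hvw
    rw [e v hv, e w hw, hf v w (Nat.zero_le _) (Nat.zero_le _) hvw.1 z, hvw.2]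

/-- Pumping in the padded part turns infinity of a fiber into nonemptiness of one with longer
padding, to which `PumpAt.le_encard_fiber` applies. -/
theorem encard_fiber_eq_top_iff [Encodable β] {B : ℕ} (h : PumpAt L 0 N)
    (hB : ∀ w ∈ L, ∀ b ∈ w, Encodable.encode b ≤ B) (y : List α) :
    (fiber L π 0 y).encard = ⊤ ↔ (1 : ℕ) ≤ (fiber L π (N * 2) y).encard := by
  rw [Nat.cast_one, Set.one_le_encard_iff_nonempty, Set.encard_eq_top_iff]
  constructor
  · intro hinf
    by_contra hne
    refine hinf (finite_of_bounded (B := B) (n := y.length + N * 2) (fun w hw => hB w hw.1)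
      fun w hw => ?_)
    by_contra hl
    exact hne ⟨w, hw.1, by omega, hw.2.2⟩
  · rintro ⟨w, hw⟩
    exact (h.fiber y).infinite ⟨hw.1, by have := hw.2.1; omega, hw.2.2⟩ hw.2.1

/-- A bound for the number of colours of the set of words with `κ` words above them. -/
def fiberBound (κ : Option ℕ) (N : ℕ) : ℕ :=
  (κ.getD 0 + 2) ^ N * (κ.getD 0 + 2) ^ N

theorem primrec_fiberBound : Primrec₂ fiberBound :=
  have h : Primrec fun x : Option ℕ × ℕ => (x.1.getD 0 + 2) ^ x.2 :=
    primrec_pow.comp (Primrec.nat_add.comp (Primrec.option_getD.comp .fst (.const 0)) (.const 2)) .snd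
  Primrec.nat_mul.comp h h

theorem PumpAt.encard_fiber_eq [Encodable β] {B : ℕ} (h : PumpAt L 0 N)
    (hB : ∀ w ∈ L, ∀ b ∈ w, Encodable.encode b ≤ B) (κ : Option ℕ) :
    PumpAt {y | (AutomaticTrees.fiber L π 0 y).encard = toENat κ} s (fiberBound κ N) := by
  rcases κ with _ | k
  · simp only [toENat, Option.elim, encard_fiber_eq_top_iff h hB]
    exact (h.le_encard_fiber 1).mono le_rfl (Nat.le_mul_of_pos_right _ (by positivity))
  · have e : {y | (AutomaticTrees.fiber L π 0 y).encard = toENat (some k)} =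
        {y | k ≤ (AutomaticTrees.fiber L π 0 y).encard} ∩
          {y | (k + 1 : ℕ) ≤ (AutomaticTrees.fiber L π 0 y).encard}ᶜ := by
      ext y
      simp only [toENat, Option.elim, Set.mem_inter_iff, Set.mem_ofPred_eq, Set.mem_compl_iff]
      rw [Nat.cast_add, Nat.cast_one, ENat.add_one_le_iff (ENat.natCast_ne_top k), not_lt,
        eq_comm, le_antisymm_iff]
    rw [e]
    refine ((h.le_encard_fiber k).inter (h.le_encard_fiber (k + 1)).compl).mono le_rfl ?_
    exact Nat.mul_le_mul (Nat.pow_le_pow_left (by simp) _) (Nat.pow_le_pow_left (by simp) _)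

theorem primrecPred_fiber [Primcodable α] [Primcodable β] (hπ : Primrec π) :
    PrimrecPred fun x : (FinAut β × List α) × List β => x.2 ∈ fiber x.1.1.language π 0 x.1.2 :=
  PrimrecPred.and (FinAut.primrecPred_mem_language.comp ((Primrec.fst.comp .fst).pair .snd))
    (PrimrecPred.and (Primrec.nat_le.comp (Primrec.list_length.comp (Primrec.snd.comp .fst))
      (Primrec.list_length.comp .snd)) (Primrec.eq.comp (Primrec.list_map .snd (hπ.comp .snd).to₂)
        (primrec_pad.comp (Primrec.snd.comp .fst) (Primrec.list_length.comp .snd))))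

theorem exists_primrec_encard_fiber [Primcodable α] [Primcodable β] (hπ : Primrec π) :
    ∃ C : FinAut β × List α → Option ℕ, Primrec C ∧
      ∀ A y, toENat (C (A, y)) = (fiber A.language π 0 y).encard := by
  obtain ⟨C, hC, h⟩ := exists_primrec_encard
    (p := fun (x : FinAut β × List α) w => w ∈ fiber x.1.language π 0 x.2)
    (B := fun x => x.1.letterBound) (s := fun x => x.2.length) (N := fun x => x.1.stateBound * 2)
    (primrecPred_fiber hπ) (FinAut.primrec_letterBound.comp .fst) (Primrec.list_length.comp .snd)
    (Primrec.nat_mul.comp (FinAut.primrec_stateBound.comp .fst) (.const 2))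
  exact ⟨C, hC, fun A y => h (A, y) (fun w hw b hb => FinAut.encode_le_letterBound hw.1 hb)
    ((A.pumpAt_language 0).fiber y)⟩

end Fiber

/-! ### Convolutions -/

@[simp]
theorem length_conv (u v : List ℕ) : (conv u v).length = max u.length v.length := by
  simp [conv]

theorem map_fst_conv (u v : List ℕ) : (conv u v).map Prod.fst = pad u (conv u v).length := by
  simp [conv, pad]

theorem map_snd_conv (u v : List ℕ) : (conv u v).map Prod.snd = pad v (conv u v).length := by
  simp [conv, pad]

theorem conv_injective {u v u' v' : List ℕ} (h : conv u v = conv u' v') : u = u' ∧ v = v' := by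
  have hl : max u.length v.length = max u'.length v'.length := by
    simpa using congrArg List.length h
  constructor
  · refine pad_injective (n := (conv u v).length) (by simp) (by simp [hl]) ?_
    rw [← map_fst_conv, h, map_fst_conv]
  · refine pad_injective (n := (conv u v).length) (by simp) (by simp [hl]) ?_
    rw [← map_snd_conv, h, map_snd_conv]

theorem conv_append {u x : List ℕ} (h : u.length ≤ x.length) (z : List ℕ) :
    conv u (x ++ z) = conv u x ++ z.map fun a => (none, some a) := by
  refine List.ext_getElem (by simp; omega) fun i h1 h2 => ?_
  by_cases hi : i < x.length
  · rw [List.getElem_append_left (by simp [hi])]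
    simp [conv, List.getElem?_append_left hi]
  · have hi' : i < x.length + z.length := by
      simp at h1
      omega
    rw [List.getElem_append_right (by simp; omega)]
    simp [conv, List.getElem?_append_right (not_lt.1 hi), max_eq_right h]
    omega

theorem mem_conv_of_mem_right {u v : List ℕ} {a : ℕ} (h : a ∈ v) :
    ∃ o, (o, some a) ∈ conv u v := by
  obtain ⟨i, hi, rfl⟩ := List.mem_iff_getElem.1 h
  exact ⟨u[i]?, List.mem_map.2 ⟨i, List.mem_range.2 (by omega), by simp [hi]⟩⟩

theorem primrec_conv : Primrec₂ conv :=
  Primrec.list_map (Primrec.list_range.comp (Primrec.nat_max.comp (Primrec.list_length.comp .fst)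
    (Primrec.list_length.comp .snd))) ((Primrec.list_getElem?.comp (Primrec.fst.comp .fst) .snd).pair
      (Primrec.list_getElem?.comp (Primrec.snd.comp .fst) .snd)).to₂

/-- Once `u` is exhausted, lengthening `y` just appends letters `(none, some a)`. This is why
`PumpAt` has a starting length. -/
theorem PumpAt.conv {L : Set (List (Option ℕ × Option ℕ))} {N : ℕ} (h : PumpAt L 0 N)
    (u : List ℕ) : PumpAt {y | conv u y ∈ L} u.length N := by
  obtain ⟨σ, _, f, hσ, hf⟩ := h
  refine ⟨σ, inferInstance, fun y => f (AutomaticTrees.conv u y), hσ, fun x y hx hy hxy z => ?_⟩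
  rw [Set.mem_ofPred_eq, Set.mem_ofPred_eq, conv_append hx, conv_append hy]
  exact hf _ _ (Nat.zero_le _) (Nat.zero_le _) hxy _

/-! ### Numbers of ancestors and descendants in a presentation -/

namespace Presentation

theorem primrec_dom : Primrec Presentation.dom :=
  Primrec.fst.comp (Primrec.of_equiv (e := Presentation.equivProd))

theorem primrec_rel : Primrec Presentation.rel :=
  Primrec.snd.comp (Primrec.of_equiv (e := Presentation.equivProd))

/-- The relation of a presentation, as a relation on words. -/
def R (P : Presentation) (u v : List ℕ) : Prop :=
  conv u v ∈ P.rel.language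

/-- The number of accepted words with first projection `u`. -/
noncomputable def down (P : Presentation) (u : List ℕ) : ℕ∞ :=
  (fiber P.rel.language Prod.fst 0 u).encard

/-- The number of accepted words with second projection `u`. -/
noncomputable def up (P : Presentation) (u : List ℕ) : ℕ∞ :=
  (fiber P.rel.language Prod.snd 0 u).encard

/-- In a tree, `y` is a child of `u`. -/
def Child (P : Presentation) (u y : List ℕ) : Prop :=
  P.R u y ∧ P.up y = P.up u + 1

theorem primrecPred_R {α : Type} [Primcodable α] {P : α → Presentation} {u v : α → List ℕ}
    (hP : Primrec P) (hu : Primrec u) (hv : Primrec v) : PrimrecPred fun a => (P a).R (u a) (v a) :=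
  FinAut.primrecPred_mem_language.comp ((primrec_rel.comp hP).pair (primrec_conv.comp hu hv))

theorem primrecPred_dom {α : Type} [Primcodable α] {P : α → Presentation} {u : α → List ℕ}
    (hP : Primrec P) (hu : Primrec u) : PrimrecPred fun a => u a ∈ (P a).dom.language :=
  FinAut.primrecPred_mem_language.comp ((primrec_dom.comp hP).pair hu)

theorem exists_primrec_down : ∃ C : Presentation × List ℕ → Option ℕ, Primrec C ∧
    ∀ P u, toENat (C (P, u)) = P.down u := by
  obtain ⟨C, hC, h⟩ := exists_primrec_encard_fiber
    (π := (Prod.fst : Option ℕ × Option ℕ → Option ℕ)) Primrec.fst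
  exact ⟨fun x => C (x.1.rel, x.2), hC.comp ((primrec_rel.comp .fst).pair .snd), fun P u => h _ _⟩

theorem exists_primrec_up : ∃ C : Presentation × List ℕ → Option ℕ, Primrec C ∧
    ∀ P u, toENat (C (P, u)) = P.up u := by
  obtain ⟨C, hC, h⟩ := exists_primrec_encard_fiber
    (π := (Prod.snd : Option ℕ × Option ℕ → Option ℕ)) Primrec.snd
  exact ⟨fun x => C (x.1.rel, x.2), hC.comp ((primrec_rel.comp .fst).pair .snd), fun P u => h _ _⟩

theorem primrecPred_up {α : Type} [Primcodable α] {P : α → Presentation} {u : α → List ℕ}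
    {p : ℕ∞ → Prop} (hP : Primrec P) (hu : Primrec u) (hp : PrimrecPred fun o => p (toENat o)) :
    PrimrecPred fun a => p ((P a).up (u a)) := by
  obtain ⟨C, hC, h⟩ := exists_primrec_up
  exact (hp.comp (hC.comp (hP.pair hu))).of_eq fun a => by rw [h]

theorem toENat_map_succ (o : Option ℕ) : toENat (o.map Nat.succ) = toENat o + 1 := by
  cases o <;> simp [toENat]

theorem primrecPred_child {α : Type} [Primcodable α] {P : α → Presentation} {u v : α → List ℕ}
    (hP : Primrec P) (hu : Primrec u) (hv : Primrec v) :
    PrimrecPred fun a => (P a).Child (u a) (v a) := by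
  obtain ⟨C, hC, h⟩ := exists_primrec_up
  refine ((primrecPred_R hP hu hv).and (Primrec.eq.comp (hC.comp (hP.pair hv))
    (Primrec.option_map (hC.comp (hP.pair hu)) (Primrec.succ.comp .snd).to₂))).of_eq fun a => ?_
  refine and_congr_right fun _ => ?_
  rw [← toENat_injective.eq_iff, toENat_map_succ, h, h]

theorem exists_primrec_child : ∃ C : (Presentation × List ℕ) × Option ℕ → Option ℕ, Primrec C ∧
    ∀ P u κ, toENat (C ((P, u), κ)) =
      {y | P.Child u y ∧ P.down y = toENat κ}.encard := by
  obtain ⟨U, hU, hU'⟩ := exists_primrec_up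
  obtain ⟨D, hD, hD'⟩ := exists_primrec_down
  have hrel : Primrec fun a : (Presentation × List ℕ) × Option ℕ => a.1.1.rel :=
    primrec_rel.comp (Primrec.fst.comp .fst)
  have hstate := FinAut.primrec_stateBound.comp hrel
  obtain ⟨C, hC, h⟩ := exists_primrec_encard
    (p := fun (a : (Presentation × List ℕ) × Option ℕ) y =>
      a.1.1.Child a.1.2 y ∧ a.1.1.down y = toENat a.2)
    (B := fun a => a.1.1.rel.letterBound) (s := fun a => a.1.2.length)
    (N := fun a => a.1.1.rel.stateBound * fiberBound ((U a.1).map Nat.succ) a.1.1.rel.stateBound *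
      fiberBound a.2 a.1.1.rel.stateBound)
    (PrimrecPred.and (primrecPred_child (Primrec.fst.comp (Primrec.fst.comp .fst))
        (Primrec.snd.comp (Primrec.fst.comp .fst)) .snd)
      ((Primrec.eq.comp (hD.comp ((Primrec.fst.comp (Primrec.fst.comp .fst)).pair .snd))
        (Primrec.snd.comp .fst)).of_eq fun a => by rw [← toENat_injective.eq_iff, hD']))
    (FinAut.primrec_letterBound.comp hrel)
    (Primrec.list_length.comp (Primrec.snd.comp .fst))
    (Primrec.nat_mul.comp (Primrec.nat_mul.comp hstate (primrec_fiberBound.comp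
      (Primrec.option_map (hU.comp .fst) (Primrec.succ.comp .snd).to₂) hstate))
      (primrec_fiberBound.comp .snd hstate))
  refine ⟨C, hC, fun P u κ => h ((P, u), κ) (fun y hy b hb => ?_) ?_⟩
  · obtain ⟨o, ho⟩ := mem_conv_of_mem_right (u := u) hb
    refine le_trans ?_ (FinAut.encode_le_letterBound hy.1.1 ho)
    refine le_trans ?_ (Nat.right_le_pair _ _)
    simp
  · have hL : PumpAt P.rel.language 0 P.rel.stateBound := P.rel.pumpAt_language 0
    have hB : ∀ w ∈ P.rel.language, ∀ b ∈ w, Encodable.encode b ≤ P.rel.letterBound :=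
      fun w hw b hb => FinAut.encode_le_letterBound hw hb
    refine cast ?_ (((hL.conv u).inter (hL.encard_fiber_eq (π := Prod.snd) hB
      ((U (P, u)).map Nat.succ))).inter (hL.encard_fiber_eq (π := Prod.fst) hB κ))
    congr 1
    rw [toENat_map_succ, hU']
    rfl

theorem primrecPred_dom_nonempty : PrimrecPred fun P : Presentation => ∃ w, w ∈ P.dom.language :=
  primrecPred_exists_word (p := fun (P : Presentation) w => w ∈ P.dom.language)
    (B := fun P => P.dom.letterBound) (s := fun _ => 0) (N := fun P => P.dom.stateBound)
    (primrecPred_dom .fst .snd) (FinAut.primrec_letterBound.comp primrec_dom) (.const 0)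
    (FinAut.primrec_stateBound.comp primrec_dom)
    (fun _ _ hw _ hb => FinAut.encode_le_letterBound hw hb) fun P => P.dom.pumpAt_language 0

end Presentation

/-! ### Isomorphism invariants -/

/-- The values of the invariants of trees of height at most `k + 1`. -/
def Inv : ℕ → Type
  | 0 => ℕ∞
  | k + 1 => Inv k → ℕ∞

/-- The isomorphism invariants of nodes: the number of descendants `d` at height at most one, and
the numbers of children with given invariant above. -/
noncomputable def inv {V : Type} (ch : V → V → Prop) (d : V → ℕ∞) : (k : ℕ) → V → Inv k
  | 0, u => d u
  | k + 1, u => fun t => {y | ch u y ∧ inv ch d k y = t}.encard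

theorem le_encard_iff {V : Type} {S : Set V} {l : ℕ} :
    l ≤ S.encard ↔ ∃ ys : List V, ys.Nodup ∧ ys.length = l ∧ ∀ y ∈ ys, y ∈ S := by
  classical
  constructor
  · intro h
    obtain ⟨F, hF, hFl⟩ := Set.exists_subset_encard_eq h
    have hfin : F.Finite := Set.finite_of_encard_eq_coe hFl
    refine ⟨hfin.toFinset.toList, Finset.nodup_toList _, ?_, fun y hy => hF (by simpa using hy)⟩
    rw [Finset.length_toList]
    rw [hfin.encard_eq_coe_toFinset_card] at hFl
    exact_mod_cast hFl
  · rintro ⟨ys, hys, rfl, h⟩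
    rw [← List.toFinset_card_of_nodup hys, ← Set.encard_coe_eq_coe_finsetCard]
    exact Set.encard_le_encard fun y hy => h y (by simpa using hy)

theorem primrecPred_nodup {α : Type} [Primcodable α] : PrimrecPred fun l : List α => l.Nodup := by
  have h : PrimrecPred fun l : List α => ∀ i ∈ List.range l.length, ∀ j ∈ List.range l.length,
      l[i]? = l[j]? → i = j := by
    have hr : Primrec fun l : List α => List.range l.length :=
      Primrec.list_range.comp Primrec.list_length
    refine PrimrecPred.forall_mem hr (PrimrecPred.forall_mem (hr.comp .fst) ?_)
    have h1 := PrimrecPred.not (Primrec.eq.comp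
      (Primrec.list_getElem?.comp (α := (List α × ℕ) × ℕ) (Primrec.fst.comp .fst)
        (Primrec.snd.comp .fst))
      (Primrec.list_getElem?.comp (Primrec.fst.comp .fst) .snd))
    exact (h1.or (Primrec.eq.comp (Primrec.snd.comp .fst) .snd)).of_eq fun a => by tauto
  refine h.of_eq fun l => ?_
  rw [List.nodup_iff_injective_get]
  constructor
  · intro h i j hij
    refine Fin.ext (h i (by simp) j (by simp) ?_)
    simpa using hij
  · intro h i hi j hj hij
    rw [List.mem_range] at hi hj
    have := @h ⟨i, hi⟩ ⟨j, hj⟩ (by simpa [hi, hj] using hij)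
    exact Fin.ext_iff.1 this

namespace Presentation

/-- The invariant of a node of a presentation. -/
noncomputable def nodeInv (k : ℕ) (x : Presentation × List ℕ) : Inv k :=
  inv x.1.Child x.1.down k x.2

/-- A witness is a list of `l` distinct children with the required invariant; finding it costs one
existential quantifier over a condition in the dual class. -/
theorem sigmaPred_le_nodeInv {k s : ℕ}
    (h : SigmaPred (s + 1) ((Presentation × List ℕ) × Presentation × List ℕ) fun x =>
      nodeInv k x.1 ≠ nodeInv k x.2) :
    SigmaPred (s + 2) ((Presentation × List ℕ) × (Presentation × List ℕ) × ℕ) fun x =>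
      x.2.2 ≤ nodeInv (k + 1) x.1 (nodeInv k x.2.1) := by
  have h1 : PrimrecPred fun x : ((Presentation × List ℕ) × (Presentation × List ℕ) × ℕ) ×
      List (List ℕ) => x.2.Nodup ∧ x.2.length = x.1.2.2 ∧ ∀ y ∈ x.2, x.1.1.1.Child x.1.1.2 y :=
    (primrecPred_nodup.comp .snd).and ((Primrec.eq.comp (Primrec.list_length.comp .snd)
      (Primrec.snd.comp (Primrec.snd.comp .fst))).and (PrimrecPred.forall_mem .snd
        (primrecPred_child (Primrec.fst.comp (Primrec.fst.comp (Primrec.fst.comp .fst)))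
          (Primrec.snd.comp (Primrec.fst.comp (Primrec.fst.comp .fst))) .snd)))
  -- The bounded universal quantifier over the list is handled by its negation, whose existential
  -- quantifier is absorbed at level `s + 1`.
  have h2 : SigmaPred (s + 1) (((Presentation × List ℕ) × (Presentation × List ℕ) × ℕ) ×
      List (List ℕ)) fun x => ∃ y, y ∈ x.2 ∧ nodeInv k (x.1.1.1, y) ≠ nodeInv k x.1.2.1 := by
    refine SigmaPred.exists_of (SigmaPred.and (SigmaPred.of_primrec ?_)
      (h.comp (f := fun x : (((Presentation × List ℕ) × (Presentation × List ℕ) × ℕ) ×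
      List (List ℕ)) × List ℕ => ((x.1.1.1.1, x.2), x.1.1.2.1)) ?_))
    · exact (PrimrecPred.exists_mem (p := fun (x : _ × List ℕ) b => x.2 = b)
        (Primrec.snd.comp .fst) (Primrec.eq.comp (Primrec.snd.comp .fst) .snd)).of_eq
          fun a => by simp
    · exact (Primrec.pair (Primrec.fst.comp (Primrec.fst.comp (Primrec.fst.comp .fst))) .snd).pair
        (Primrec.fst.comp (Primrec.snd.comp (Primrec.fst.comp .fst)))
  refine (SigmaPred.exists_of (p := fun (x : (Presentation × List ℕ) × (Presentation × List ℕ) × ℕ)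
    ys => ¬ (¬ (ys.Nodup ∧ ys.length = x.2.2 ∧ ∀ y ∈ ys, x.1.1.Child x.1.2 y) ∨
      ∃ y, y ∈ ys ∧ nodeInv k (x.1.1, y) ≠ nodeInv k x.2.1))
    (SigmaPred.of_not (((SigmaPred.of_primrec h1.not).or h2).of_eq fun a => not_not.symm))).of_eq
    fun x => ?_
  change _ ↔ (x.2.2 : ℕ∞) ≤ Set.encard _
  rw [le_encard_iff]
  refine exists_congr fun ys => ?_
  rw [not_or, not_not, and_assoc, and_assoc]
  refine and_congr_right fun _ => and_congr_right fun _ => ?_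
  push Not
  exact forall₂_and.symm

/-- The arguments `t` need not be quantified over all of `Inv k`: the larger count is nonzero, so
`t` is the invariant of an actual child `w` of `x`. The smaller count `c` is finite, and `l = c + 1`
separates the two. -/
theorem exists_lt_of_inv_ne {k : ℕ} {x y : Presentation × List ℕ} {t : Inv k}
    (h : nodeInv (k + 1) y t < nodeInv (k + 1) x t) : ∃ (w : List ℕ) (l : ℕ),
      l ≤ nodeInv (k + 1) x (nodeInv k (x.1, w)) ∧
      ¬ l ≤ nodeInv (k + 1) y (nodeInv k (x.1, w)) := by
  obtain ⟨c, hc⟩ := ENat.ne_top_iff_exists.1 h.ne_top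
  have hpos : nodeInv (k + 1) x t ≠ 0 := (pos_of_gt h).ne'
  obtain ⟨w, -, rfl⟩ := Set.encard_ne_zero.1 hpos
  refine ⟨w, c + 1, ?_, ?_⟩
  · rw [Nat.cast_add, Nat.cast_one, ENat.add_one_le_iff (ENat.natCast_ne_top c), hc]
    exact h
  · change ¬ _ ≤ nodeInv (k + 1) y (inv x.1.Child x.1.down k w)
    rw [← hc, not_le]
    exact_mod_cast Nat.lt_succ_self c

theorem sigmaPred_nodeInv_ne (j : ℕ) :
    SigmaPred (2 * j + 1) ((Presentation × List ℕ) × Presentation × List ℕ) fun x =>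
      nodeInv (j + 1) x.1 ≠ nodeInv (j + 1) x.2 := by
  induction j with
  | zero =>
    obtain ⟨C, hC, h⟩ := exists_primrec_child
    refine (SigmaPred.exists_of (m := 0) (β := Option ℕ)
      (p := fun (x : (Presentation × List ℕ) × Presentation × List ℕ) κ => C (x.1, κ) ≠ C (x.2, κ))
      (SigmaPred.of_primrec (PrimrecPred.not (Primrec.eq.comp
        (hC.comp ((Primrec.fst.comp .fst).pair .snd))
        (hC.comp ((Primrec.snd.comp .fst).pair .snd)))))).of_eq fun x => ?_
    rw [← not_iff_not, not_exists, not_ne_iff]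
    constructor
    · intro hx
      refine funext (α := ℕ∞) fun t => ?_
      obtain ⟨κ, hκ⟩ := exists_toENat t
      have := congrArg toENat (not_ne_iff.1 (hx κ))
      rw [h, h, hκ] at this
      exact this
    · intro hx κ
      rw [not_ne_iff, ← toENat_injective.eq_iff, h, h]
      exact congrFun (α := ℕ∞) hx (toENat κ)
  | succ j ih =>
    have hle := sigmaPred_le_nodeInv ih
    -- The witness `w` is read in the presentation of the first node, so both orders of the two
    -- nodes are needed below.
    let G : (Presentation × List ℕ) × (Presentation × List ℕ) → List ℕ → ℕ → Prop := fun x w l =>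
      l ≤ nodeInv (j + 2) x.1 (nodeInv (j + 1) (x.1.1, w)) ∧
        ¬ l ≤ nodeInv (j + 2) x.2 (nodeInv (j + 1) (x.1.1, w))
    have key : ∀ f : (((Presentation × List ℕ) × Presentation × List ℕ) × List ℕ) × ℕ →
        (Presentation × List ℕ) × (Presentation × List ℕ), Primrec f →
        SigmaPred (2 * j + 2 + 1)
          ((((Presentation × List ℕ) × Presentation × List ℕ) × List ℕ) × ℕ)
          fun z => G (f z) z.1.2 z.2 := by
      intro f hf
      have e : Primrec fun z => (((f z).1.1, z.1.2), z.2) :=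
        (Primrec.pair (Primrec.fst.comp (Primrec.fst.comp hf)) (Primrec.snd.comp .fst)).pair .snd
      exact SigmaPred.and (hle.comp ((Primrec.fst.comp hf).pair e)).succ
        (SigmaPred.of_not ((hle.comp ((Primrec.snd.comp hf).pair e)).of_eq fun z => not_not.symm))
    have h1 := key (fun z => z.1.1) (Primrec.fst.comp .fst)
    have h2 := key (fun z => (z.1.1.2, z.1.1.1))
      ((Primrec.snd.comp (Primrec.fst.comp .fst)).pair (Primrec.fst.comp (Primrec.fst.comp .fst)))
    have hG : ∀ x w l, G x w l ↔ l ≤ nodeInv (j + 2) x.1 (nodeInv (j + 1) (x.1.1, w)) ∧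
        ¬ l ≤ nodeInv (j + 2) x.2 (nodeInv (j + 1) (x.1.1, w)) := fun _ _ _ => Iff.rfl
    clear_value G
    have h3 : SigmaPred (2 * j + 2 + 1) (((Presentation × List ℕ) × Presentation × List ℕ) × List ℕ)
        fun z => ∃ l, G z.1 z.2 l ∨ G (z.1.2, z.1.1) z.2 l :=
      SigmaPred.exists_of (m := 2 * j + 2) (p := fun (z : ((Presentation × List ℕ) ×
        Presentation × List ℕ) × List ℕ) l => G z.1 z.2 l ∨ G (z.1.2, z.1.1) z.2 l) (h1.or h2)
    have h4 : SigmaPred (2 * j + 2 + 1) ((Presentation × List ℕ) × Presentation × List ℕ)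
        fun x => ∃ w l, G x w l ∨ G (x.2, x.1) w l :=
      SigmaPred.exists_of (m := 2 * j + 2) (p := fun (x : (Presentation × List ℕ) ×
        Presentation × List ℕ) w => ∃ l, G x w l ∨ G (x.2, x.1) w l) h3
    refine h4.of_eq fun x => ?_
    simp only [hG]
    constructor
    · rintro ⟨w, l, ⟨h, h'⟩ | ⟨h, h'⟩⟩ heq
      · rw [heq] at h
        exact h' h
      · rw [← heq] at h
        exact h' h
    · intro hne
      obtain ⟨t, ht⟩ := Function.ne_iff.1 hne
      rcases lt_or_gt_of_ne ht with h | h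
      · obtain ⟨w, l, h⟩ := exists_lt_of_inv_ne h
        exact ⟨w, l, Or.inr h⟩
      · obtain ⟨w, l, h⟩ := exists_lt_of_inv_ne h
        exact ⟨w, l, Or.inl h⟩

end Presentation

/-! ### Forests and the completeness of the invariants -/

/-- A relation that is, on its field, a partial order in which the sets of ancestors are finite and
linearly ordered. -/
structure IsForest {V : Type} (r : V → V → Prop) : Prop where
  left : ∀ x y, r x y → r x x
  right : ∀ x y, r x y → r y y
  antisymm : ∀ x y, r x y → r y x → x = y
  trans : ∀ x y z, r x y → r y z → r x z
  finite : ∀ x, {y | r y x}.Finite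
  linear : ∀ x y z, r y x → r z x → r y z ∨ r z y

section Forest

variable {V W : Type} {r : V → V → Prop} {s : W → W → Prop}

/-- The number of ancestors. -/
noncomputable def nUp (r : V → V → Prop) (y : V) : ℕ∞ := {x | r x y}.encard

/-- The number of descendants. -/
noncomputable def nDown (r : V → V → Prop) (x : V) : ℕ∞ := {y | r x y}.encard

/-- `y` is a child of `u`. -/
def IsChild (r : V → V → Prop) (u y : V) : Prop := r u y ∧ nUp r y = nUp r u + 1

namespace IsForest

theorem nUp_ne_top (hr : IsForest r) (x : V) : nUp r x ≠ ⊤ :=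
  Set.encard_ne_top_iff.2 (hr.finite x)

theorem nUp_add_one_le (hr : IsForest r) {x y : V} (h : r x y) (hne : x ≠ y) :
    nUp r x + 1 ≤ nUp r y := by
  rw [ENat.add_one_le_iff (hr.nUp_ne_top x)]
  refine (hr.finite x).encard_lt_encard ⟨fun z hz => hr.trans _ _ _ hz h, fun hsub => hne ?_⟩
  exact hr.antisymm _ _ h (hsub (hr.right _ _ h))

theorem ne_of_isChild (hr : IsForest r) {u c : V} (h : IsChild r u c) : u ≠ c := by
  rintro rfl
  exact ((ENat.lt_add_one_iff (hr.nUp_ne_top u)).2 le_rfl).ne h.2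

/-- Both lie below `y`, hence are comparable; having equally many ancestors, they coincide. -/
theorem isChild_unique (hr : IsForest r) {u c c' y : V} (hc : IsChild r u c) (hc' : IsChild r u c')
    (h : r c y) (h' : r c' y) : c = c' := by
  by_contra hne
  have hlt : ∀ x, nUp r x + 1 ≤ nUp r x → False := fun x hx =>
    ((ENat.add_one_le_iff (hr.nUp_ne_top x)).1 hx).ne rfl
  rcases hr.linear _ _ _ h h' with hcc | hcc
  · have := hr.nUp_add_one_le hcc hne
    rw [hc'.2, ← hc.2] at this
    exact hlt _ this
  · have := hr.nUp_add_one_le hcc (Ne.symm hne)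
    rw [hc.2, ← hc'.2] at this
    exact hlt _ this

theorem exists_minimal (hr : IsForest r) {p : V → Prop} {y : V} (hy : r y y) (hp : p y) :
    ∃ c, r c y ∧ p c ∧ ∀ x, r x c → p x → x = c := by
  obtain ⟨c, ⟨hc, hpc⟩, hmin⟩ := Set.exists_min_image {x | r x y ∧ p x} (nUp r)
    ((hr.finite y).subset fun x hx => hx.1) ⟨y, hy, hp⟩
  refine ⟨c, hc, hpc, fun x hx hpx => ?_⟩
  by_contra hne
  have h1 := hr.nUp_add_one_le hx hne
  have h2 := hmin x ⟨hr.trans _ _ _ hx hc, hpx⟩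
  exact ((ENat.add_one_le_iff (hr.nUp_ne_top x)).1 (h1.trans h2)).ne rfl

/-- A minimal `c` strictly above `u` and below `y` has only itself and the ancestors of `u` as
ancestors. -/
theorem exists_isChild (hr : IsForest r) {u y : V} (h : r u y) (hne : u ≠ y) :
    ∃ c, IsChild r u c ∧ r c y := by
  obtain ⟨c, hcy, ⟨huc, hne⟩, hmin⟩ :=
    hr.exists_minimal (p := fun x => r u x ∧ u ≠ x) (hr.right _ _ h) ⟨h, hne⟩
  refine ⟨c, ⟨huc, ?_⟩, hcy⟩
  have e : {x | r x c} = insert c {x | r x u} := by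
    ext x
    constructor
    · intro hx
      by_cases hxu : r x u
      · exact Or.inr hxu
      · have hux : r u x := (hr.linear _ _ _ hx huc).resolve_left hxu
        refine Or.inl (hmin x hx ⟨hux, ?_⟩)
        rintro rfl
        exact hxu hux
    · rintro (rfl | hx)
      · exact hr.right _ _ huc
      · exact hr.trans _ _ _ hx huc
  unfold nUp
  rw [e, Set.encard_insert_of_notMem (show c ∉ {x | r x u} from fun hcu =>
    hne (hr.antisymm _ _ huc hcu))]

/-- The nodes of a subtree are its root and the nodes of the subtrees at the children of the root. -/
noncomputable def subtreeEquiv (hr : IsForest r) {u : V} (hu : r u u) :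
    Option (Σ c : {c // IsChild r u c}, {z // r c.1 z}) ≃ {y // r u y} :=
  Equiv.ofBijective (fun o => o.elim ⟨u, hu⟩ fun z => ⟨z.2.1, hr.trans _ _ _ z.1.2.1 z.2.2⟩) <| by
    have h0 : ∀ z : Σ c : {c // IsChild r u c}, {z // r c.1 z}, z.2.1 ≠ u := by
      rintro ⟨⟨c, hc⟩, z, hz⟩ h
      obtain rfl : z = u := h
      exact hr.ne_of_isChild hc (hr.antisymm _ _ hc.1 hz)
    constructor
    · rintro (_ | ⟨⟨c, hc⟩, z, hz⟩) (_ | ⟨⟨c', hc'⟩, z', hz'⟩) h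
      · rfl
      · exact absurd (Subtype.ext_iff.1 h).symm (h0 ⟨⟨c', hc'⟩, z', hz'⟩)
      · exact absurd (Subtype.ext_iff.1 h) (h0 ⟨⟨c, hc⟩, z, hz⟩)
      · obtain rfl : z = z' := Subtype.ext_iff.1 h
        obtain rfl : c = c' := hr.isChild_unique hc hc' hz hz'
        rfl
    · rintro ⟨y, hy⟩
      by_cases hne : u = y
      · subst hne
        exact ⟨none, rfl⟩
      · obtain ⟨c, hc, hcy⟩ := hr.exists_isChild hy hne
        exact ⟨some ⟨⟨c, hc⟩, y, hcy⟩, rfl⟩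

/-- The order of a subtree, in terms of the decomposition of `subtreeEquiv`. -/
def subtreeRel (r : V → V → Prop) {u : V} :
    Option (Σ c : {c // IsChild r u c}, {z // r c.1 z}) →
      Option (Σ c : {c // IsChild r u c}, {z // r c.1 z}) → Prop
  | none, _ => True
  | some _, none => False
  | some x, some y => x.1 = y.1 ∧ r x.2.1 y.2.1

theorem subtreeRel_iff (hr : IsForest r) {u : V} (hu : r u u)
    (x y : Option (Σ c : {c // IsChild r u c}, {z // r c.1 z})) :
    r (hr.subtreeEquiv hu x).1 (hr.subtreeEquiv hu y).1 ↔ subtreeRel r x y := by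
  rcases x with _ | ⟨⟨c, hc⟩, z, hz⟩
  · exact iff_of_true (hr.subtreeEquiv hu y).2 trivial
  · rcases y with _ | ⟨⟨c', hc'⟩, z', hz'⟩
    · refine iff_of_false (fun h => ?_) id
      exact hr.ne_of_isChild hc (hr.antisymm _ _ hc.1 (hr.trans _ _ _ hz h))
    · refine ⟨fun h => ⟨Subtype.ext ?_, h⟩, fun h => h.2⟩
      exact hr.isChild_unique hc hc' (hr.trans _ _ _ hz h) hz'

end IsForest

/-! ### Completeness and isomorphism invariance of the invariants. -/

theorem equiv_of_encard_eq [Countable V] [Countable W] {A : Set V} {B : Set W}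
    (h : A.encard = B.encard) : Nonempty (A ≃ B) := by
  refine Cardinal.eq.1 (Cardinal.toENat_injOn ?_ ?_ h)
  · exact Cardinal.mk_le_aleph0
  · exact Cardinal.mk_le_aleph0

/-- The order on the subtree at a node. -/
def subtree (r : V → V → Prop) (u : V) (x y : {y // r u y}) : Prop := r x.1 y.1

theorem exists_equiv_preserving {A B T : Type} [Countable A] [Countable B] {f : A → T} {g : B → T}
    (h : ∀ t, {a | f a = t}.encard = {b | g b = t}.encard) : ∃ e : A ≃ B, ∀ a, g (e a) = f a := by
  have hφ : ∀ t, Nonempty ({a // f a = t} ≃ {b // g b = t}) := fun t => equiv_of_encard_eq (h t)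
  refine ⟨(Equiv.sigmaFiberEquiv f).symm.trans ((Equiv.sigmaCongrRight fun t => (hφ t).some).trans
    (Equiv.sigmaFiberEquiv g)), fun a => ?_⟩
  exact ((hφ (f a)).some ⟨a, rfl⟩).2

/-- In depth one the order is determined by the root, so a bijection of nodes suffices. In larger
depth, children are matched by invariant and the isomorphisms given by induction are glued along
`subtreeEquiv`. -/
theorem nonempty_subtree_iso [Countable V] [Countable W] (hr : IsForest r) (hs : IsForest s) {k : ℕ}
    {u : V} {v : W} (hu : r u u) (hv : s v v)
    (hur : ∀ y, r u y → nUp r y ≤ nUp r u + (k + 1 : ℕ))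
    (hvs : ∀ y, s v y → nUp s y ≤ nUp s v + (k + 1 : ℕ))
    (h : inv (IsChild r) (nDown r) k u = inv (IsChild s) (nDown s) k v) :
    Nonempty (subtree r u ≃r subtree s v) := by
  induction k generalizing u v with
  | zero =>
    have flat : ∀ {V : Type} {r : V → V → Prop} (_ : IsForest r) {u : V} (_ : r u u)
        (_ : ∀ y, r u y → nUp r y ≤ nUp r u + (0 + 1 : ℕ)) (x y : {y // r u y}),
        r x.1 y.1 ↔ x = ⟨u, ‹_›⟩ ∨ x = y := by
      intro V r hr u hu hur x y
      constructor
      · intro hxy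
        by_contra hne
        rw [not_or] at hne
        have h1 := hr.nUp_add_one_le x.2 fun h => hne.1 (Subtype.ext h.symm)
        have h2 := hr.nUp_add_one_le hxy fun h => hne.2 (Subtype.ext h)
        have h3 := (hur y.1 y.2).trans h1
        exact ((ENat.add_one_le_iff (hr.nUp_ne_top _)).1 (h2.trans h3)).ne rfl
      · rintro (rfl | rfl)
        · exact y.2
        · exact hr.right _ _ x.2
    obtain ⟨e⟩ : Nonempty ({y // r u y} ≃ {y // s v y}) := equiv_of_encard_eq h
    classical
    -- The bijection is corrected so that it maps root to root.
    obtain ⟨e, he⟩ : ∃ e : {y // r u y} ≃ {y // s v y}, e ⟨u, hu⟩ = ⟨v, hv⟩ :=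
      ⟨_, e.setValue_eq ⟨u, hu⟩ ⟨v, hv⟩⟩
    refine ⟨⟨e, fun {x y} => ?_⟩⟩
    unfold subtree
    rw [flat hr hu hur, flat hs hv hvs, ← he, e.apply_eq_iff_eq, e.apply_eq_iff_eq]
  | succ k ih =>
    have hcount : ∀ {V : Type} (p : V → Prop) (f : V → Inv k) (t : Inv k),
        {c : {c // p c} | f c.1 = t}.encard = {c | p c ∧ f c = t}.encard := by
      intro V p f t
      rw [← Subtype.val_injective.encard_image]
      congr 1
      ext c
      simp [and_comm]
    obtain ⟨e, he⟩ := exists_equiv_preserving (A := {c // IsChild r u c}) (B := {c // IsChild s v c})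
      (f := fun c => inv (IsChild r) (nDown r) k c.1)
      (g := fun c => inv (IsChild s) (nDown s) k c.1) fun t => by
        rw [hcount, hcount]
        exact congrFun h t
    have depth : ∀ {V : Type} {r : V → V → Prop} (_ : IsForest r) {u : V}
        (_ : ∀ y, r u y → nUp r y ≤ nUp r u + (k + 1 + 1 : ℕ)) (c : {c // IsChild r u c}) (y : V),
        r c.1 y → nUp r y ≤ nUp r c.1 + (k + 1 : ℕ) := by
      intro V r hr u hur c y hy
      refine (hur y (hr.trans _ _ _ c.2.1 hy)).trans_eq ?_
      rw [c.2.2]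
      push_cast
      ring
    have hφ : ∀ c : {c // IsChild r u c}, Nonempty (subtree r c.1 ≃r subtree s (e c).1) := fun c =>
      ih (hr.right _ _ c.2.1) (hs.right _ _ (e c).2.1) (depth hr hur c) (depth hs hvs (e c))
        (he c).symm
    have φ := fun c => (hφ c).some
    let G := Equiv.optionCongr (Equiv.sigmaCongr (β₁ := fun c : {c // IsChild r u c} => {z // r c.1 z})
      (β₂ := fun c : {c // IsChild s v c} => {z // s c.1 z}) e fun c => (φ c).toEquiv)
    have hG : ∀ x y, IsForest.subtreeRel s (G x) (G y) ↔ IsForest.subtreeRel r x y := by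
      rintro (_ | ⟨c, z⟩) (_ | ⟨c', z'⟩)
      · exact Iff.rfl
      · exact Iff.rfl
      · exact Iff.rfl
      · by_cases hc : c = c'
        · subst hc
          exact and_congr (iff_of_true rfl rfl) (φ c).map_rel_iff
        · exact iff_of_false (fun h => hc (e.injective h.1)) fun h => hc h.1
    refine ⟨⟨(hr.subtreeEquiv hu).symm.trans (G.trans (hs.subtreeEquiv hv)), fun {x y} => ?_⟩⟩
    unfold subtree
    simp only [Equiv.trans_apply]
    rw [hs.subtreeRel_iff, hG, ← hr.subtreeRel_iff hu, Equiv.apply_symm_apply,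
      Equiv.apply_symm_apply]

theorem encard_congr_of_equiv {A : Set V} {B : Set W} (e : A ≃ B) {p : V → Prop} {q : W → Prop}
    (hp : ∀ x, p x → x ∈ A) (hq : ∀ y, q y → y ∈ B) (h : ∀ x, p x.1 ↔ q (e x).1) :
    {x | p x}.encard = {y | q y}.encard := by
  have h1 : {x | p x} = (fun x : A => x.1) '' {x | p x.1} := by
    ext x
    simpa using hp x
  have h2 : {y | q y} = (fun x : A => (e x).1) '' {x | p x.1} := by
    ext y
    constructor
    · intro hy
      refine ⟨e.symm ⟨y, hq y hy⟩, (h _).2 ?_, ?_⟩ <;> simp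
      exact hy
    · rintro ⟨x, hx, rfl⟩
      exact (h x).1 hx
  have hinj : Function.Injective fun x : A => (e x).1 := Subtype.val_injective.comp e.injective
  rw [h1, h2, Subtype.val_injective.encard_image, hinj.encard_image]

theorem inv_eq_of_iso {A : Set V} {B : Set W} (hA : ∀ x y, r x y → x ∈ A ∧ y ∈ A)
    (hB : ∀ x y, s x y → x ∈ B ∧ y ∈ B) (e : A ≃ B) (h : ∀ x y, r x.1 y.1 ↔ s (e x).1 (e y).1)
    (k : ℕ) (x : A) :
    inv (IsChild r) (nDown r) k x.1 = inv (IsChild s) (nDown s) k (e x).1 := by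
  have hup : ∀ x : A, nUp r x.1 = nUp s (e x).1 := fun x =>
    encard_congr_of_equiv e (fun y hy => (hA _ _ hy).1) (fun y hy => (hB _ _ hy).1) fun y => h y x
  induction k generalizing x with
  | zero =>
    exact encard_congr_of_equiv e (fun y hy => (hA _ _ hy).2) (fun y hy => (hB _ _ hy).2)
      fun y => h x y
  | succ k ih =>
    refine funext fun t => encard_congr_of_equiv e (fun y hy => (hA _ _ hy.1.1).2)
      (fun y hy => (hB _ _ hy.1.1).2) fun y => ?_
    rw [IsChild, IsChild, h, hup, hup, ih]

end Forest

/-! ### Presentations of trees -/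

theorem filterMap_pad {y : List ℕ} {n : ℕ} (h : y.length ≤ n) : (pad y n).filterMap id = y := by
  obtain ⟨m, rfl⟩ := Nat.exists_eq_add_of_le h
  rw [pad_of_le le_rfl]
  have e : pad y y.length = y.map some := by simpa [pad] using pad_append y [] 0
  rw [e, List.filterMap_append, List.filterMap_map]
  simp

theorem filterMap_conv (u v : List ℕ) :
    (conv u v).filterMap Prod.fst = u ∧ (conv u v).filterMap Prod.snd = v := by
  constructor
  · have h := filterMap_pad (y := u) (n := (conv u v).length) (by simp)
    rwa [← map_fst_conv, List.filterMap_map] at h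
  · have h := filterMap_pad (y := v) (n := (conv u v).length) (by simp)
    rwa [← map_snd_conv, List.filterMap_map] at h

/-- The only candidates for `u` and `v` are the two tracks with padding removed, so no search is
needed. -/
theorem exists_conv_iff {w : List (Option ℕ × Option ℕ)} {p : List ℕ → List ℕ → Prop} :
    (∃ u v, w = conv u v ∧ p u v) ↔
      w = conv (w.filterMap Prod.fst) (w.filterMap Prod.snd) ∧
        p (w.filterMap Prod.fst) (w.filterMap Prod.snd) := by
  constructor
  · rintro ⟨u, v, rfl, h⟩
    rw [(filterMap_conv u v).1, (filterMap_conv u v).2]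
    exact ⟨rfl, h⟩
  · exact fun h => ⟨_, _, h⟩

theorem primrecPred_exists_conv {α : Type} [Primcodable α] {p : α → List ℕ → List ℕ → Prop}
    {w : α → List (Option ℕ × Option ℕ)} (hw : Primrec w)
    (hp : PrimrecPred fun x : α × List ℕ × List ℕ => p x.1 x.2.1 x.2.2) :
    PrimrecPred fun a => ∃ u v, w a = conv u v ∧ p a u v := by
  have h1 : Primrec fun a => (w a).filterMap Prod.fst :=
    Primrec.listFilterMap hw (Primrec.fst.comp .snd).to₂
  have h2 : Primrec fun a => (w a).filterMap Prod.snd :=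
    Primrec.listFilterMap hw (Primrec.snd.comp .snd).to₂
  exact ((Primrec.eq.comp hw (primrec_conv.comp h1 h2)).and
    (hp.comp (Primrec.id.pair (h1.pair h2)))).of_eq fun a => exists_conv_iff.symm

namespace Presentation

variable {P : Presentation}

theorem isAutomatic_iff : P.IsAutomatic ↔ ∀ w, w ∈ P.rel.language →
    ∃ u v, w = conv u v ∧ u ∈ P.dom.language ∧ v ∈ P.dom.language := by
  refine forall₂_congr fun w _ => ⟨?_, ?_⟩
  · rintro ⟨u, hu, v, hv, rfl⟩
    exact ⟨u, v, rfl, hu, hv⟩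
  · rintro ⟨u, v, rfl, hu, hv⟩
    exact ⟨u, hu, v, hv, rfl⟩

theorem sigmaPred_not_isAutomatic : SigmaPred 1 Presentation fun P => ¬ P.IsAutomatic := by
  have h1 : PrimrecPred fun x : Presentation × List (Option ℕ × Option ℕ) =>
      x.2 ∈ x.1.rel.language :=
    FinAut.primrecPred_mem_language.comp ((primrec_rel.comp .fst).pair .snd)
  have h2 : PrimrecPred fun x : Presentation × List (Option ℕ × Option ℕ) =>
      ∃ u v, x.2 = conv u v ∧ u ∈ x.1.dom.language ∧ v ∈ x.1.dom.language :=
    primrecPred_exists_conv .snd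
      ((primrecPred_dom (Primrec.fst.comp .fst) (Primrec.fst.comp .snd)).and
        (primrecPred_dom (Primrec.fst.comp .fst) (Primrec.snd.comp .snd)))
  refine (SigmaPred.of_not_forall (p := fun (P : Presentation) w => w ∈ P.rel.language →
    ∃ u v, w = conv u v ∧ u ∈ P.dom.language ∧ v ∈ P.dom.language)
    ((h1.not.or h2).of_eq fun x => by tauto)).of_eq fun P => ?_
  rw [isAutomatic_iff]

theorem IsAutomatic.mem_dom (hP : P.IsAutomatic) {u v : List ℕ} (h : P.R u v) :
    u ∈ P.dom.language ∧ v ∈ P.dom.language := by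
  obtain ⟨u', hu, v', hv, e⟩ := hP _ h
  obtain ⟨rfl, rfl⟩ := conv_injective e
  exact ⟨hu, hv⟩

/-- `up` counts accepted words and is computable for every pair of automata; it counts ancestors
once all accepted words are convolutions. -/
theorem IsAutomatic.up_eq (hP : P.IsAutomatic) : P.up = nUp P.R := by
  funext v
  have hinj : Function.Injective fun u => conv u v := fun u u' h => (conv_injective h).1
  unfold up nUp
  rw [← hinj.encard_image]
  congr 1
  ext w
  constructor
  · rintro ⟨hw, hl, hm⟩
    obtain ⟨u, -, v', -, rfl⟩ := hP w hw
    rw [map_snd_conv] at hm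
    obtain rfl := pad_injective (by simp) hl hm
    exact ⟨u, hw, rfl⟩
  · rintro ⟨u, hu, rfl⟩
    exact ⟨hu, by simp, map_snd_conv _ _⟩

theorem IsAutomatic.down_eq (hP : P.IsAutomatic) : P.down = nDown P.R := by
  funext u
  have hinj : Function.Injective fun v => conv u v := fun v v' h => (conv_injective h).2
  unfold down nDown
  rw [← hinj.encard_image]
  congr 1
  ext w
  constructor
  · rintro ⟨hw, hl, hm⟩
    obtain ⟨u', -, v, -, rfl⟩ := hP w hw
    rw [map_fst_conv] at hm
    obtain rfl := pad_injective (by simp) hl hm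
    exact ⟨v, hw, rfl⟩
  · rintro ⟨v, hv, rfl⟩
    exact ⟨hv, by simp, map_fst_conv _ _⟩

theorem IsAutomatic.nodeInv_eq (hP : P.IsAutomatic) (k : ℕ) (u : List ℕ) :
    nodeInv k (P, u) = inv (IsChild P.R) (nDown P.R) k u := by
  have h : P.Child = IsChild P.R := by
    funext u y
    rw [Child, hP.up_eq]
    rfl
  change inv P.Child P.down k u = _
  rw [h, hP.down_eq]

/-- The first-order conditions of a tree of height at most `n` on the nodes `x`, `y`, `z`. -/
def NodeCond (n : ℕ) (P : Presentation) (x y z : List ℕ) : Prop :=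
  (x ∈ P.dom.language → P.R x x ∧ P.up x ≤ n + 1) ∧ (P.R x y → P.R y x → x = y) ∧
    (P.R x y → P.R y z → P.R x z) ∧ (P.R y x → P.R z x → P.R y z ∨ P.R z y) ∧
    (x ∈ P.dom.language → y ∈ P.dom.language → P.up x = 1 → P.up y = 1 → x = y)

/-- An automatic presentation with these properties presents a tree of height at most `n`. -/
def TreeCond (n : ℕ) (P : Presentation) : Prop :=
  (∃ w, w ∈ P.dom.language) ∧ ∀ t : List ℕ × List ℕ × List ℕ, NodeCond n P t.1 t.2.1 t.2.2

theorem primrecPred_toENat_le (n : ℕ) : PrimrecPred fun o : Option ℕ => toENat o ≤ (n + 1 : ℕ∞) := by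
  refine (PrimrecPred.and (PrimrecPred.not (Primrec.eq.comp .id (.const none)))
    (Primrec.nat_le.comp (Primrec.option_getD.comp .id (.const 0)) (.const (n + 1)))).of_eq fun o => ?_
  cases o
  · simp only [toENat, Option.elim, id, not_true_eq_false, false_and, false_iff, top_le_iff]
    exact_mod_cast ENat.natCast_ne_top (n + 1)
  · simp only [toENat, Option.elim, id, Option.getD_some, reduceCtorEq, not_false_eq_true, true_and]
    exact_mod_cast Iff.rfl

theorem primrecPred_up_eq_one {α : Type} [Primcodable α] {P : α → Presentation} {u : α → List ℕ}
    (hP : Primrec P) (hu : Primrec u) : PrimrecPred fun a => (P a).up (u a) = 1 :=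
  primrecPred_up (p := fun c => c = 1) hP hu <|
    (Primrec.eq.comp .id (.const (some 1))).of_eq fun o => by
      rw [← toENat_injective.eq_iff]
      simp [toENat]

/-- Finiteness and height become a bound on `up`, and the root becomes uniqueness of a node with one
ancestor. Apart from nonemptiness, which is decidable, only universal quantifiers over a decidable
condition remain. -/
theorem sigmaPred_not_treeCond (n : ℕ) : SigmaPred 1 Presentation fun P => ¬ P.TreeCond n := by
  let X := Presentation × List ℕ × List ℕ × List ℕ
  have hP : Primrec fun t : X => t.1 := .fst
  have hx : Primrec fun t : X => t.2.1 := Primrec.fst.comp .snd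
  have hy : Primrec fun t : X => t.2.2.1 := Primrec.fst.comp (Primrec.snd.comp .snd)
  have hz : Primrec fun t : X => t.2.2.2 := Primrec.snd.comp (Primrec.snd.comp .snd)
  have ax : PrimrecPred fun t : X => NodeCond n t.1 t.2.1 t.2.2.1 t.2.2.2 := by
    have imp : ∀ {p q : X → Prop}, PrimrecPred p → PrimrecPred q → PrimrecPred fun t => p t → q t :=
      fun hp hq => (hp.not.or hq).of_eq fun t => imp_iff_not_or.symm
    have hxD := primrecPred_dom hP hx
    refine (imp hxD ((primrecPred_R hP hx hx).and
      (primrecPred_up hP hx (primrecPred_toENat_le n)))).and ?_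
    refine (imp (primrecPred_R hP hx hy) (imp (primrecPred_R hP hy hx) (Primrec.eq.comp hx hy))).and
      ?_
    refine (imp (primrecPred_R hP hx hy) (imp (primrecPred_R hP hy hz)
      (primrecPred_R hP hx hz))).and ?_
    refine (imp (primrecPred_R hP hy hx) (imp (primrecPred_R hP hz hx)
      ((primrecPred_R hP hy hz).or (primrecPred_R hP hz hy)))).and ?_
    exact imp hxD (imp (primrecPred_dom hP hy) (imp (primrecPred_up_eq_one hP hx)
      (imp (primrecPred_up_eq_one hP hy) (Primrec.eq.comp hx hy))))
  refine ((SigmaPred.of_primrec primrecPred_dom_nonempty.not).or (SigmaPred.of_not_forall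
    (p := fun (P : Presentation) (t : List ℕ × List ℕ × List ℕ) => NodeCond n P t.1 t.2.1 t.2.2)
    ax)).of_eq fun P => ?_
  rw [TreeCond, not_and_or]

theorem TreeCond.nodeCond {n : ℕ} (h : P.TreeCond n) (x y z : List ℕ) : NodeCond n P x y z :=
  h.2 (x, y, z)

theorem TreeCond.isForest {n : ℕ} (hP : P.IsAutomatic) (h : P.TreeCond n) : IsForest P.R where
  left x y hxy := ((h.nodeCond x x x).1 (hP.mem_dom hxy).1).1
  right x y hxy := ((h.nodeCond y x x).1 (hP.mem_dom hxy).2).1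
  antisymm x y := (h.nodeCond x y x).2.1
  trans x y z := (h.nodeCond x y z).2.2.1
  finite x := by
    by_cases hx : x ∈ P.dom.language
    · have h1 := ((h.nodeCond x x x).1 hx).2
      rw [hP.up_eq] at h1
      refine Set.encard_ne_top_iff.1 (ne_top_of_le_ne_top ?_ h1)
      exact_mod_cast ENat.natCast_ne_top (n + 1)
    · rw [(Set.eq_empty_iff_forall_notMem (s := {y | P.R y x})).2 fun y hy => hx (hP.mem_dom hy).2]
      exact Set.finite_empty
  linear x y z := (h.nodeCond x y z).2.2.2.1

/-- Every node has a minimal ancestor, which is its own only ancestor; by uniqueness of such a node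
all nodes share it. -/
theorem TreeCond.exists_root {n : ℕ} (hP : P.IsAutomatic) (h : P.TreeCond n) :
    ∃ o, o ∈ P.dom.language ∧ P.up o = 1 ∧ ∀ x, x ∈ P.dom.language → P.R o x := by
  have hmin : ∀ x, x ∈ P.dom.language → ∃ o, P.R o x ∧ o ∈ P.dom.language ∧ P.up o = 1 := by
    intro x hx
    obtain ⟨o, ho, -, hmin⟩ := (h.isForest hP).exists_minimal (p := fun _ => True)
      ((h.nodeCond x x x).1 hx).1 trivial
    have hoD := (hP.mem_dom ho).1
    refine ⟨o, ho, hoD, ?_⟩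
    rw [hP.up_eq, nUp, Set.encard_eq_one]
    refine ⟨o, Set.eq_singleton_iff_unique_mem.2 ⟨((h.nodeCond o o o).1 hoD).1, fun y hy => ?_⟩⟩
    exact hmin y hy trivial
  obtain ⟨w, hw⟩ := h.1
  obtain ⟨o, -, hoD, ho⟩ := hmin w hw
  refine ⟨o, hoD, ho, fun x hx => ?_⟩
  obtain ⟨o', hox, hoD', ho'⟩ := hmin x hx
  rwa [(h.nodeCond o o' o).2.2.2.2 hoD hoD' ho ho']

theorem nUp_val {x : P.Dom} (hP : P.IsAutomatic) :
    nUp P.R x.1 = {y : P.Dom | P.Rel y x}.encard := by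
  unfold nUp
  rw [← Function.Injective.encard_image (f := fun y : P.Dom => y.1) Subtype.val_injective]
  congr 1
  ext y
  constructor
  · exact fun hy => ⟨⟨y, (hP.mem_dom hy).1⟩, hy, rfl⟩
  · rintro ⟨y, hy, rfl⟩
    exact hy

/-- Ancestors include the node itself, which accounts for the bound `n + 1` in `NodeCond`. -/
theorem level_add_one {x : P.Dom} (hP : P.IsAutomatic) (hx : P.Rel x x) :
    level P.Rel x + 1 = nUp P.R x.1 := by
  rw [nUp_val hP, level, ← Set.encard_insert_of_notMem (a := x) (by simp)]
  congr 1
  ext y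
  simp only [Set.mem_insert_iff, Set.mem_ofPred_eq]
  by_cases hy : y = x
  · subst hy
    simpa using hx
  · simp [hy]

theorem treeOfHeightLE_iff {n : ℕ} (hP : P.IsAutomatic) :
    TreeOfHeightLE n P.Dom P.Rel ↔ P.TreeCond n := by
  have hlevel : ∀ x : P.Dom, P.Rel x x → (level P.Rel x ≤ n ↔ P.up x.1 ≤ n + 1) := fun x hx => by
    rw [hP.up_eq, ← level_add_one hP hx]
    exact (WithTop.add_le_add_iff_right ENat.one_ne_top).symm
  constructor
  · rintro ⟨ht, hh⟩
    obtain ⟨o, ho⟩ := ht.root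
    refine ⟨⟨o.1, o.2⟩, fun ⟨x, y, z⟩ => ⟨fun hx => ?_, fun hxy hyx => ?_, fun hxy hyz => ?_,
      fun hyx hzx => ?_, fun hx hy h1 h2 => ?_⟩⟩
    · have hxx := ht.refl ⟨x, hx⟩
      exact ⟨hxx, (hlevel ⟨x, hx⟩ hxx).1 ((le_iSup (level P.Rel) _).trans hh)⟩
    · have hd := hP.mem_dom hxy
      exact Subtype.ext_iff.1 (ht.antisymm ⟨x, hd.1⟩ ⟨y, hd.2⟩ hxy hyx)
    · have hd := hP.mem_dom hxy
      exact ht.trans ⟨x, hd.1⟩ ⟨y, hd.2⟩ ⟨z, (hP.mem_dom hyz).2⟩ hxy hyz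
    · have hd := hP.mem_dom hyx
      exact ht.linear ⟨x, hd.2⟩ ⟨y, hd.1⟩ ⟨z, (hP.mem_dom hzx).1⟩ hyx hzx
    · have key : ∀ x, x ∈ P.dom.language → P.up x = 1 → x = o.1 := by
        intro x hx h1
        rw [hP.up_eq, nUp, Set.encard_eq_one] at h1
        obtain ⟨a, ha⟩ := h1
        have e1 : x = a := (Set.ext_iff.1 ha x).1 (ht.refl ⟨x, hx⟩)
        have e2 : o.1 = a := (Set.ext_iff.1 ha o.1).1 (ho ⟨x, hx⟩)
        rw [e1, e2]
      exact (key x hx h1).trans (key y hy h2).symm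
  · intro h
    have hrefl : ∀ x : P.Dom, P.Rel x x := fun x => ((h.nodeCond x.1 x.1 x.1).1 x.2).1
    refine ⟨⟨hrefl, fun x y hxy hyx => Subtype.ext ((h.nodeCond x.1 y.1 x.1).2.1 hxy hyx),
      fun x y z => (h.nodeCond x.1 y.1 z.1).2.2.1, ?_, fun x => ?_,
      fun x y z => (h.nodeCond x.1 y.1 z.1).2.2.2.1⟩, ?_⟩
    · obtain ⟨o, ho, -, hle⟩ := h.exists_root hP
      exact ⟨⟨o, ho⟩, fun x => hle x.1 x.2⟩
    · rw [← Set.encard_ne_top_iff, ← nUp_val hP]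
      exact (h.isForest hP).nUp_ne_top _
    · exact iSup_le fun x => (hlevel x (hrefl x)).2 ((h.nodeCond x.1 x.1 x.1).1 x.2).2

end Presentation

/-! ### The isomorphism problem in terms of the invariants of the roots. -/

theorem TreeOfHeightLE.of_iso {n : ℕ} {V W : Type} {r : V → V → Prop} {s : W → W → Prop}
    (h : TreeOfHeightLE n W s) (e : r ≃r s) : TreeOfHeightLE n V r := by
  obtain ⟨ht, hh⟩ := h
  have he : ∀ x y, r x y ↔ s (e x) (e y) := fun x y => e.map_rel_iff.symm
  refine ⟨⟨fun x => (he _ _).2 (ht.refl _), fun x y hxy hyx => e.injective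
    (ht.antisymm _ _ ((he _ _).1 hxy) ((he _ _).1 hyx)), fun x y z hxy hyz =>
    (he _ _).2 (ht.trans _ _ _ ((he _ _).1 hxy) ((he _ _).1 hyz)), ?_, fun x => ?_,
    fun x y z hyx hzx => ?_⟩, iSup_le fun x => ?_⟩
  · obtain ⟨o, ho⟩ := ht.root
    exact ⟨e.symm o, fun x => (he _ _).2 (by simpa using ho (e x))⟩
  · exact ((ht.finite (e x)).preimage e.injective.injOn).subset fun y hy => (he _ _).1 hy
  · exact (ht.linear _ _ _ ((he _ _).1 hyx) ((he _ _).1 hzx)).imp (he _ _).2 (he _ _).2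
  · refine le_trans ?_ ((le_iSup (level s) (e x)).trans hh)
    refine Set.encard_le_encard_of_injOn (f := e) (fun y hy => ?_) e.injective.injOn
    exact ⟨(he _ _).1 hy.1, fun h => hy.2 (e.injective h)⟩

namespace Presentation

/-- The roots are unique, so quantifying over them universally is harmless, and it makes the
complement existential. -/
theorem mem_isoProblem_iff {k : ℕ} {p : Presentation × Presentation} :
    p ∈ isoProblem (TreeOfHeightLE (k + 1)) ↔ p.1.IsAutomatic ∧ p.2.IsAutomatic ∧
      p.1.TreeCond (k + 1) ∧ p.2.TreeCond (k + 1) ∧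
      ∀ u v, u ∈ p.1.dom.language ∧ p.1.up u = 1 ∧ v ∈ p.2.dom.language ∧ p.2.up v = 1 →
        nodeInv k (p.1, u) = nodeInv k (p.2, v) := by
  obtain ⟨P, Q⟩ := p
  constructor
  · rintro ⟨hP, hQ, ⟨e⟩, hK⟩
    have hTP := (treeOfHeightLE_iff hP).1 (hK.of_iso e)
    have hTQ := (treeOfHeightLE_iff hQ).1 hK
    refine ⟨hP, hQ, hTP, hTQ, fun u v ⟨hu, hu1, hv, hv1⟩ => ?_⟩
    have he : (e ⟨u, hu⟩).1 = v := by
      refine (hTQ.nodeCond _ v v).2.2.2.2 (e ⟨u, hu⟩).2 hv ?_ hv1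
      rw [hQ.up_eq, nUp_val hQ, ← hu1, hP.up_eq]
      refine (nUp_val (x := ⟨u, hu⟩) hP).symm ▸ ?_
      rw [← e.injective.encard_image]
      congr 1
      ext y
      constructor
      · exact fun hy => ⟨e.symm y, e.map_rel_iff.1 (by simpa using hy), by simp⟩
      · rintro ⟨y, hy, rfl⟩
        exact e.map_rel_iff.2 hy
    rw [hP.nodeInv_eq, hQ.nodeInv_eq, ← he]
    exact inv_eq_of_iso (A := {w | w ∈ P.dom.language}) (B := {w | w ∈ Q.dom.language})
      (fun x y h => hP.mem_dom h) (fun x y h => hQ.mem_dom h) e.toEquiv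
      (fun x y => e.map_rel_iff.symm) k ⟨u, hu⟩
  · rintro ⟨hP, hQ, hTP, hTQ, h⟩
    refine ⟨hP, hQ, ?_, (treeOfHeightLE_iff hQ).2 hTQ⟩
    obtain ⟨u, hu, hu1, hur⟩ := hTP.exists_root hP
    obtain ⟨v, hv, hv1, hvs⟩ := hTQ.exists_root hQ
    have h := h u v ⟨hu, hu1, hv, hv1⟩
    rw [hP.nodeInv_eq, hQ.nodeInv_eq] at h
    have depth : ∀ {P : Presentation} (_ : P.IsAutomatic) (_ : P.TreeCond (k + 1)) {u : List ℕ}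
        (_ : P.up u = 1) (y : List ℕ), P.R u y → nUp P.R y ≤ nUp P.R u + (k + 1 : ℕ) := by
      intro P hP hT u hu y hy
      rw [← hP.up_eq, hu]
      refine ((hT.nodeCond y y y).1 (hP.mem_dom hy).2).2.trans_eq ?_
      rw [add_comm]
    obtain ⟨φ⟩ := nonempty_subtree_iso (hTP.isForest hP) (hTQ.isForest hQ) (hur u hu) (hvs v hv)
      (depth hP hTP hu1) (depth hQ hTQ hv1) h
    let toSub : ∀ {P : Presentation} (_ : P.IsAutomatic) {u : List ℕ}
        (_ : ∀ x, x ∈ P.dom.language → P.R u x), P.Rel ≃r subtree P.R u := fun hP _ hr =>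
      ⟨Equiv.subtypeEquivRight fun x => ⟨hr x, fun h => (hP.mem_dom h).2⟩, Iff.rfl⟩
    exact ⟨((toSub hP hur).trans φ).trans (toSub hQ hvs).symm⟩

/-- `u` and `v` are roots of presentations whose invariants differ. -/
def RootsNe (k : ℕ) (p : Presentation × Presentation) (u v : List ℕ) : Prop :=
  (u ∈ p.1.dom.language ∧ p.1.up u = 1 ∧ v ∈ p.2.dom.language ∧ p.2.up v = 1) ∧
    nodeInv k (p.1, u) ≠ nodeInv k (p.2, v)

theorem sigmaPred_rootsNe (j : ℕ) :
    SigmaPred (2 * j + 1) (((Presentation × Presentation) × List ℕ) × List ℕ) fun t =>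
      RootsNe (j + 1) t.1.1 t.1.2 t.2 := by
  have hP : Primrec fun t : ((Presentation × Presentation) × List ℕ) × List ℕ => t.1.1.1 :=
    Primrec.fst.comp (Primrec.fst.comp .fst)
  have hQ : Primrec fun t : ((Presentation × Presentation) × List ℕ) × List ℕ => t.1.1.2 :=
    Primrec.snd.comp (Primrec.fst.comp .fst)
  have hu : Primrec fun t : ((Presentation × Presentation) × List ℕ) × List ℕ => t.1.2 :=
    Primrec.snd.comp .fst
  have h := (sigmaPred_nodeInv_ne j).comp ((hP.pair hu).pair (hQ.pair .snd))
  exact (SigmaPred.of_primrec ((primrecPred_dom hP hu).and ((primrecPred_up_eq_one hP hu).and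
    ((primrecPred_dom hQ .snd).and (primrecPred_up_eq_one hQ .snd))))).and h

theorem sigmaPred_exists_rootsNe (j : ℕ) :
    SigmaPred (2 * j + 1) (Presentation × Presentation) fun p => ∃ u v, RootsNe (j + 1) p u v :=
  SigmaPred.exists_of (m := 2 * j) (p := fun (p : Presentation × Presentation) u =>
    ∃ v, RootsNe (j + 1) p u v) <| SigmaPred.exists_of (m := 2 * j)
      (p := fun (t : (Presentation × Presentation) × List ℕ) v => RootsNe (j + 1) t.1 t.2 v)
      (sigmaPred_rootsNe j)

theorem isPi_isoProblem (j : ℕ) : IsPi (2 * j + 1) (isoProblem (TreeOfHeightLE (j + 2 : ℕ))) := by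
  have lift : ∀ {q : Presentation → Prop} {f : Presentation × Presentation → Presentation},
      SigmaPred 1 Presentation q → Primrec f →
      SigmaPred (2 * j + 1) (Presentation × Presentation) fun p => q (f p) :=
    fun hq hf => (hq.comp hf).mono (by omega)
  have h1 := lift sigmaPred_not_isAutomatic .fst
  have h2 := lift sigmaPred_not_isAutomatic .snd
  have h3 := lift (sigmaPred_not_treeCond (j + 1 + 1)) .fst
  have h4 := lift (sigmaPred_not_treeCond (j + 1 + 1)) .snd
  have h5 := h1.or (h2.or (h3.or (h4.or (sigmaPred_exists_rootsNe j))))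
  refine SigmaPred.isSigma (h5.of_eq fun p => ?_)
  rw [Set.mem_compl_iff, mem_isoProblem_iff]
  simp only [RootsNe, not_and_or, not_forall, exists_prop, ne_eq]

end Presentation

/-! ### Trees of height at most one -/

/-- A word in the range of `f` receives the colour of its preimage; one extra colour marks words
that cannot be continued into the image. -/
theorem PumpAt.image {β : Type} {D : Set (List ℕ)} {s K : ℕ} (hD : PumpAt D 0 K)
    {f : List ℕ → List β} (hf : Function.Injective f) {g : ℕ → β}
    (h : ∀ x z, s ≤ x.length → (x ++ z ∈ f '' D ↔
      ∃ v₁ v₂, x = f v₁ ∧ z = v₂.map g ∧ v₁ ++ v₂ ∈ D)) : PumpAt (f '' D) s (K + 1) := by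
  obtain ⟨σ, _, c, hc, hcol⟩ := hD
  classical
  refine ⟨Option σ, inferInstance, fun x => if hx : ∃ v, x = f v then some (c hx.choose) else none,
    ?_, fun x y hx hy hxy z => ?_⟩
  · rw [Fintype.card_option]
    exact Nat.succ_le_succ hc
  · rw [h x z hx, h y z hy]
    beta_reduce at hxy
    split_ifs at hxy with h1 h2 h2
    · obtain ⟨u, rfl⟩ := id h1
      obtain ⟨v, rfl⟩ := id h2
      rw [← hf h1.choose_spec, ← hf h2.choose_spec, Option.some_inj] at hxy
      have key := hcol u v (Nat.zero_le _) (Nat.zero_le _) hxy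
      constructor
      · rintro ⟨u', v₂, hu, rfl, hm⟩
        obtain rfl := hf hu
        exact ⟨v, v₂, rfl, rfl, (key _).1 hm⟩
      · rintro ⟨v', v₂, hv, rfl, hm⟩
        obtain rfl := hf hv
        exact ⟨u, v₂, rfl, rfl, (key _).2 hm⟩
    · exact iff_of_false (fun ⟨v, _, hv, _⟩ => h1 ⟨v, hv⟩) fun ⟨v, _, hv, _⟩ => h2 ⟨v, hv⟩

theorem conv_self (u : List ℕ) : conv u u = u.map fun a => (some a, some a) := by
  refine List.ext_getElem (by simp) fun i h1 h2 => ?_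
  simp at h2
  simp [conv, h2]

theorem PumpAt.image_conv_self {D : Set (List ℕ)} {K : ℕ} (hD : PumpAt D 0 K) :
    PumpAt ((fun u => AutomaticTrees.conv u u) '' D) 0 (K + 1) := by
  refine hD.image (fun u v h => (conv_injective h).1) (g := fun a => (some a, some a))
    fun x z _ => ?_
  simp only [Set.mem_image, conv_self]
  constructor
  · rintro ⟨u, hu, h⟩
    obtain ⟨u₁, u₂, rfl, rfl, rfl⟩ := List.map_eq_append_iff.1 h
    exact ⟨u₁, u₂, rfl, rfl, hu⟩
  · rintro ⟨u₁, u₂, rfl, rfl, hu⟩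
    exact ⟨_, hu, by simp⟩

/-- Length strictly greater than that of `o` forces the second track of `conv o v₁` to be the longer
one, so that extensions only append padded letters. -/
theorem PumpAt.image_conv {D : Set (List ℕ)} {K : ℕ} (hD : PumpAt D 0 K) (o : List ℕ) :
    PumpAt (AutomaticTrees.conv o '' D) (o.length + 1) (K + 1) := by
  refine hD.image (fun u v h => (conv_injective h).2) (g := fun a => (none, some a))
    fun x z hx => ?_
  constructor
  · rintro ⟨v, hv, h⟩
    have hl : v.length = x.length + z.length := by
      have := congrArg List.length h
      simp at this
      omega
    have hl' : (v.take x.length).length = x.length := by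
      simp
      omega
    rw [← List.take_append_drop x.length v, conv_append (by omega)] at h
    obtain ⟨h1, h2⟩ := List.append_inj h (by simp; omega)
    exact ⟨_, _, h1.symm, h2.symm, by rwa [List.take_append_drop]⟩
  · rintro ⟨v₁, v₂, rfl, rfl, hv⟩
    refine ⟨_, hv, conv_append ?_ _⟩
    simp at hx
    omega

theorem PumpAt.conv_self {L : Set (List (Option ℕ × Option ℕ))} {N : ℕ} (h : PumpAt L 0 N) :
    PumpAt {x | AutomaticTrees.conv x x ∈ L} 0 N := by
  obtain ⟨σ, _, f, hσ, hf⟩ := h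
  refine ⟨σ, inferInstance, fun y => f (AutomaticTrees.conv y y), hσ, fun x y _ _ hxy z => ?_⟩
  simp only [Set.mem_ofPred_eq, AutomaticTrees.conv_self, List.map_append] at hxy ⊢
  exact hf _ _ (Nat.zero_le _) (Nat.zero_le _) hxy _

namespace Presentation

variable {P : Presentation} {o : List ℕ}

/-- The relation of `P` is a partial order of height at most one with least element `o`. -/
def IsStar (P : Presentation) (o : List ℕ) : Prop :=
  o ∈ P.dom.language ∧ (∀ x, x ∈ P.dom.language → P.R x x) ∧
    (∀ x, x ∈ P.dom.language → P.R o x) ∧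
    ∀ w, w ∈ P.rel.language →
      ∃ u v, w = conv u v ∧ v ∈ P.dom.language ∧ (u = v ∨ u = o)

/-- Each universal clause says that a set of counterexamples is empty. These sets are Boolean
combinations of sets with few colours; for the last clause the permitted words are the images of the
domain under `u ↦ conv u u` and `conv o`. -/
theorem primrecPred_isStar : PrimrecPred fun a : Presentation × List ℕ => a.1.IsStar a.2 := by
  have hdom : Primrec fun a : Presentation × List ℕ => a.1.dom := primrec_dom.comp .fst
  have hrel : Primrec fun a : Presentation × List ℕ => a.1.rel := primrec_rel.comp .fst
  have hK := FinAut.primrec_stateBound.comp hdom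
  have hN := FinAut.primrec_stateBound.comp hrel
  have hlen : Primrec fun a : Presentation × List ℕ => a.2.length := Primrec.list_length.comp .snd
  have hD : PrimrecPred fun x : (Presentation × List ℕ) × List ℕ => x.2 ∈ x.1.1.dom.language :=
    primrecPred_dom (Primrec.fst.comp .fst) .snd
  have h1 : PrimrecPred fun a : Presentation × List ℕ =>
      ∃ x, x ∈ a.1.dom.language ∧ ¬ a.1.R x x :=
    primrecPred_exists_word (p := fun (a : Presentation × List ℕ) x =>
        x ∈ a.1.dom.language ∧ ¬ a.1.R x x)
      (hD.and (primrecPred_R (Primrec.fst.comp .fst) .snd .snd).not)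
      (FinAut.primrec_letterBound.comp hdom) (.const 0) (Primrec.nat_mul.comp hK hN)
      (fun a w hw b hb => FinAut.encode_le_letterBound hw.1 hb)
      fun a => (a.1.dom.pumpAt_language 0).inter (a.1.rel.pumpAt_language 0).conv_self.compl
  have h2 : PrimrecPred fun a : Presentation × List ℕ =>
      ∃ x, x ∈ a.1.dom.language ∧ ¬ a.1.R a.2 x :=
    primrecPred_exists_word (p := fun (a : Presentation × List ℕ) x =>
        x ∈ a.1.dom.language ∧ ¬ a.1.R a.2 x)
      (hD.and (primrecPred_R (Primrec.fst.comp .fst) (Primrec.snd.comp .fst) .snd).not)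
      (FinAut.primrec_letterBound.comp hdom) hlen (Primrec.nat_mul.comp hK hN)
      (fun a w hw b hb => FinAut.encode_le_letterBound hw.1 hb)
      fun a => (a.1.dom.pumpAt_language _).inter ((a.1.rel.pumpAt_language 0).conv a.2).compl
  let p : Presentation × List ℕ → List (Option ℕ × Option ℕ) → List ℕ → List ℕ → Prop :=
    fun a _ u v => v ∈ a.1.dom.language ∧ (u = v ∨ u = a.2)
  have h3 : PrimrecPred fun x : (Presentation × List ℕ) × List (Option ℕ × Option ℕ) =>
      x.2 ∈ x.1.1.rel.language ∧ ¬ ∃ u v, x.2 = conv u v ∧ p x.1 x.2 u v := by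
    refine (FinAut.primrecPred_mem_language.comp ((hrel.comp .fst).pair .snd)).and
      (PrimrecPred.not (primrecPred_exists_conv .snd ?_))
    exact (primrecPred_dom (Primrec.fst.comp (Primrec.fst.comp .fst)) (Primrec.snd.comp .snd)).and
      ((Primrec.eq.comp (Primrec.fst.comp .snd) (Primrec.snd.comp .snd)).or
        (Primrec.eq.comp (Primrec.fst.comp .snd) (Primrec.snd.comp (Primrec.fst.comp .fst))))
  have h4 : PrimrecPred fun a : Presentation × List ℕ => ∃ w, w ∈ a.1.rel.language ∧
      ¬ ∃ u v, w = conv u v ∧ p a w u v := by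
    refine primrecPred_exists_word (p := fun (a : Presentation × List ℕ) w =>
        w ∈ a.1.rel.language ∧ ¬ ∃ u v, w = conv u v ∧ p a w u v)
      (B := fun a => a.1.rel.letterBound) (s := fun a => a.2.length + 1)
      (N := fun a => a.1.rel.stateBound * (a.1.dom.stateBound + 1) * (a.1.dom.stateBound + 1)) h3
      (FinAut.primrec_letterBound.comp hrel) (Primrec.succ.comp hlen)
      (Primrec.nat_mul.comp (Primrec.nat_mul.comp hN (Primrec.succ.comp hK)) (Primrec.succ.comp hK))
      (fun a w hw b hb => FinAut.encode_le_letterBound hw.1 hb) fun a => ?_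
    have hK := a.1.dom.pumpAt_language 0
    refine cast ?_ (((a.1.rel.pumpAt_language _).inter (hK.image_conv_self.compl.mono
      (Nat.zero_le (a.2.length + 1)) le_rfl)).inter (hK.image_conv a.2).compl)
    congr 1
    ext w
    change (w ∈ a.1.rel.language ∧ ¬ w ∈ (fun u => conv u u) '' {u | u ∈ a.1.dom.language}) ∧
      ¬ w ∈ conv a.2 '' {u | u ∈ a.1.dom.language} ↔
      w ∈ a.1.rel.language ∧ ¬ ∃ u v, w = conv u v ∧ p a w u v
    rw [and_assoc, ← not_or]
    refine and_congr_right fun hw => not_congr ?_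
    constructor
    · rintro (⟨u, hu, rfl⟩ | ⟨v, hv, rfl⟩)
      · exact ⟨u, u, rfl, hu, Or.inl rfl⟩
      · exact ⟨a.2, v, rfl, hv, Or.inr rfl⟩
    · rintro ⟨u, v, rfl, hv, rfl | rfl⟩
      · exact Or.inl ⟨u, hv, rfl⟩
      · exact Or.inr ⟨v, hv, rfl⟩
  refine ((primrecPred_dom .fst .snd).and (h1.not.and (h2.not.and h4.not))).of_eq fun a => ?_
  unfold IsStar
  push Not
  rfl

theorem isStar_iff : P.IsStar o ↔
    P.IsAutomatic ∧ P.TreeCond 1 ∧ o ∈ P.dom.language ∧ P.up o = 1 := by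
  constructor
  · rintro ⟨ho, hrefl, hle, hrel⟩
    have hP : P.IsAutomatic := isAutomatic_iff.2 fun w hw => by
      obtain ⟨u, v, rfl, hv, rfl | rfl⟩ := hrel w hw
      · exact ⟨u, u, rfl, hv, hv⟩
      · exact ⟨u, v, rfl, ho, hv⟩
    have hR : ∀ x y, P.R x y ↔ y ∈ P.dom.language ∧ (x = y ∨ x = o) := by
      refine fun x y => ⟨fun h => ?_, ?_⟩
      · obtain ⟨u, v, e, h⟩ := hrel _ h
        obtain ⟨rfl, rfl⟩ := conv_injective e
        exact h
      · rintro ⟨hy, rfl | rfl⟩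
        exacts [hrefl _ hy, hle _ hy]
    have hset : ∀ x, x ∈ P.dom.language → {y | P.R y x} = {x, o} := fun x hx => by
      ext y
      simp [hR, hx]
    have hup : ∀ x, x ∈ P.dom.language → x ≠ o → P.up x = 2 := fun x hx hne => by
      rw [hP.up_eq, nUp, hset x hx, Set.encard_pair hne]
    have hup' : P.up o = 1 := by
      rw [hP.up_eq, nUp, hset o ho]
      simp
    have hone : ∀ x, x ∈ P.dom.language → P.up x = 1 → x = o := fun x hx h1 => by
      by_contra hne
      rw [hup x hx hne] at h1
      exact absurd h1 (by norm_num)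
    refine ⟨hP, ⟨⟨o, ho⟩, fun ⟨x, y, z⟩ => ⟨fun hx => ⟨hrefl x hx, ?_⟩, ?_, ?_, ?_,
      fun hx hy h1 h2 => (hone x hx h1).trans (hone y hy h2).symm⟩⟩, ho, hup'⟩
    · by_cases hne : x = o
      · subst hne
        rw [hup']
        norm_num
      · rw [hup x hx hne]
        norm_num
    · simp only [hR]
      rintro ⟨-, rfl | rfl⟩ ⟨-, h | h⟩ <;> simp_all
    · simp only [hR]
      rintro ⟨-, rfl | rfl⟩ ⟨hz, h⟩
      · exact ⟨hz, h⟩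
      · exact ⟨hz, Or.inr rfl⟩
    · simp only [hR]
      rintro ⟨hx, rfl | rfl⟩ ⟨-, rfl | rfl⟩ <;> simp_all
  · rintro ⟨hP, hT, ho, ho1⟩
    obtain ⟨o', ho', ho1', hle⟩ := hT.exists_root hP
    obtain rfl : o = o' := (hT.nodeCond o o' o).2.2.2.2 ho ho' ho1 ho1'
    refine ⟨ho, fun x hx => ((hT.nodeCond x x x).1 hx).1, hle, fun w hw => ?_⟩
    obtain ⟨u, hu, v, hv, rfl⟩ := hP w hw
    refine ⟨u, v, rfl, hv, ?_⟩
    by_contra hne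
    rw [not_or] at hne
    have hF := hT.isForest hP
    have h1 := hF.nUp_add_one_le hw hne.1
    have h2 := hF.nUp_add_one_le (hle u hu) (Ne.symm hne.2)
    have h3 := ((hT.nodeCond v v v).1 hv).2
    rw [hP.up_eq] at h3 ho1
    rw [ho1] at h2
    -- A chain of `o`, `u`, `v` would give `v` three ancestors, but height one allows two.
    have h4 := (add_le_add_left h2 1).trans (h1.trans h3)
    norm_num at h4

/-- Words of the domain with exactly one ancestor form a set with boundedly many colours. It
consists of the root alone, so a long root could be pumped to infinitely many. -/
theorem exists_primrec_root_bound : ∃ b : Presentation → ℕ, Primrec b ∧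
    ∀ P o, P.IsStar o → Encodable.encode o ≤ b P := by
  have hN : Primrec fun P : Presentation => P.dom.stateBound * fiberBound (some 1) P.rel.stateBound :=
    Primrec.nat_mul.comp (FinAut.primrec_stateBound.comp primrec_dom)
      (primrec_fiberBound.comp (.const _) (FinAut.primrec_stateBound.comp primrec_rel))
  refine ⟨_, primrec_codeBound.comp (FinAut.primrec_letterBound.comp primrec_dom) hN,
    fun P o h => ?_⟩
  obtain ⟨hP, hT, ho, ho1⟩ := isStar_iff.1 h
  refine encode_le_codeBound ?_ fun b hb => FinAut.encode_le_letterBound ho hb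
  have hone : toENat (some 1) = 1 := Nat.cast_one
  by_contra hl
  have hpump := (P.dom.pumpAt_language 0).inter ((P.rel.pumpAt_language 0).encard_fiber_eq
    (π := Prod.snd) (fun w hw b hb => FinAut.encode_le_letterBound hw hb) (some 1))
  refine hpump.infinite (w := o) ⟨ho, ho1.trans hone.symm⟩ (by omega)
    ((Set.finite_singleton o).subset fun x hx => ?_)
  exact (hT.nodeCond x o x).2.2.2.2 hx.1 ho (hx.2.trans hone) ho1

/-- Both roots are sought among finitely many words; `IsStar` also settles automaticity and the tree
axioms, leaving only the numbers of descendants to compare. -/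
theorem isDecidable_isoProblem : IsDecidable (isoProblem (TreeOfHeightLE (1 : ℕ))) := by
  obtain ⟨b, hb, hbound⟩ := exists_primrec_root_bound
  obtain ⟨C, hC, hdown⟩ := exists_primrec_down
  have hcodes : ∀ {α : Type} [Primcodable α] {f : α → Presentation}, Primrec f →
      Primrec fun a => codesLE (List ℕ) (b (f a)) := fun hf => primrec_codesLE.comp (hb.comp hf)
  have hP : Primrec fun t : ((Presentation × Presentation) × List ℕ) × List ℕ => t.1.1.1 :=
    Primrec.fst.comp (Primrec.fst.comp .fst)
  have hQ : Primrec fun t : ((Presentation × Presentation) × List ℕ) × List ℕ => t.1.1.2 :=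
    Primrec.snd.comp (Primrec.fst.comp .fst)
  have hu : Primrec fun t : ((Presentation × Presentation) × List ℕ) × List ℕ => t.1.2 :=
    Primrec.snd.comp .fst
  have h : PrimrecPred fun p : Presentation × Presentation => ∃ u ∈ codesLE (List ℕ) (b p.1),
      ∃ v ∈ codesLE (List ℕ) (b p.2), p.1.IsStar u ∧ p.2.IsStar v ∧ C (p.1, u) = C (p.2, v) :=
    PrimrecPred.exists_mem (hcodes .fst) (PrimrecPred.exists_mem (hcodes (Primrec.snd.comp .fst))
      ((primrecPred_isStar.comp (hP.pair hu)).and ((primrecPred_isStar.comp (hQ.pair .snd)).and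
        (Primrec.eq.comp (hC.comp (hP.pair hu)) (hC.comp (hQ.pair .snd))))))
  refine (h.of_eq fun p => ?_).computablePred
  obtain ⟨P, Q⟩ := p
  rw [mem_isoProblem_iff (k := 0)]
  constructor
  · rintro ⟨u, -, v, -, hu, hv, he⟩
    obtain ⟨hP, hTP, hu, hu1⟩ := isStar_iff.1 hu
    obtain ⟨hQ, hTQ, hv, hv1⟩ := isStar_iff.1 hv
    refine ⟨hP, hQ, hTP, hTQ, fun u' v' ⟨hu', hu1', hv', hv1'⟩ => ?_⟩
    obtain rfl := (hTP.nodeCond u u' u).2.2.2.2 hu hu' hu1 hu1'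
    obtain rfl := (hTQ.nodeCond v v' v).2.2.2.2 hv hv' hv1 hv1'
    rw [← toENat_injective.eq_iff, hdown, hdown] at he
    exact he
  · rintro ⟨hP, hQ, hTP, hTQ, he⟩
    obtain ⟨u, hu, hu1, -⟩ := hTP.exists_root hP
    obtain ⟨v, hv, hv1, -⟩ := hTQ.exists_root hQ
    have hsu := isStar_iff.2 ⟨hP, hTP, hu, hu1⟩
    have hsv := isStar_iff.2 ⟨hQ, hTQ, hv, hv1⟩
    refine ⟨u, mem_codesLE.2 (hbound _ _ hsu), v, mem_codesLE.2 (hbound _ _ hsv), hsu, hsv, ?_⟩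
    rw [← toENat_injective.eq_iff, hdown, hdown]
    exact he u v ⟨hu, hu1, hv, hv1⟩

end Presentation
end AutomaticTrees

theorem proposition4p2 :
    AutomaticTrees.IsDecidable (AutomaticTrees.isoProblem (AutomaticTrees.TreeOfHeightLE 1)) ∧
    ∀ n : ℕ, 2 ≤ n →
      AutomaticTrees.IsPi (2 * n - 3)
        (AutomaticTrees.isoProblem (AutomaticTrees.TreeOfHeightLE n)) := by
  refine ⟨AutomaticTrees.Presentation.isDecidable_isoProblem, fun n hn => ?_⟩
  obtain ⟨j, rfl⟩ := Nat.exists_eq_add_of_le' hn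
  rw [show 2 * (j + 2) - 3 = 2 * j + 1 by omega]
  exact AutomaticTrees.Presentation.isPi_isoProblem j
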